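/- Let $W:\mathbb{C}^2\to\mathbb{R}$ be of the form $W(u,v)=P(|u|^2,|v|^2)$ for a polynomial $P$ in two variables with real coefficients. Consider the nonlinear Dirac equations $$ \begin{cases} i(u_t+u_x)+v=\partial_{\bar u}W(u,v),\\ i(v_t-v_x)+u=\partial_{\bar v}W(u,v),\end{cases}\qquad x\in\mathbb{R}, $$ where $\partial_{\bar z}=\frac12(\partial_{\operatorname{Re}z}+i\,\partial_{\operatorname{Im}z})$. For an interval $J\subseteq\mathbb{R}$, a solution in $C(J,H^1(\mathbb{R}))$ is a pair $\mathbf{u}=(u,v)$ of continuous functions $J\to H^1(\mathbb{R})$ which are differentiable as functions $J\to L^2(\mathbb{R})$ (one-sidedly at endpoints belonging to $J$) and satisfy the equations in $L^2(\mathbb{R})$ at every $t\in J$. Let $T>0$ and let $\mathbf{u}\in C([0,T],H^1(\mathbb{R}))$ be a solution on $[0,T]$. Then $\mathbf{u}$ extends, uniquely, to a global solution in $C(\mathbb{R},H^1(\mathbb{R}))$. -/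

import Mathlib

open MeasureTheory Set
open scoped ContDiff

noncomputable section

namespace DiracH1

/-- The Lebesgue space `L²(ℝ)` of complex-valued functions. -/
abbrev L2 : Type := Lp ℂ 2 (volume : Measure ℝ)

/-- `g` is the weak derivative of `f`: one has `∫ f φ' = - ∫ g φ` for every test function `φ`,
that is, for every smooth compactly supported function on the real line. -/
def HasWeakDeriv (f g : L2) : Prop :=
  ∀ φ : ℝ → ℂ, ContDiff ℝ ∞ φ → HasCompactSupport φ →
    ∫ x, f x * deriv φ x = - ∫ x, g x * φ x

theorem integrable_mul_test (f : L2) {φ : ℝ → ℂ} (hφ : Continuous φ)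
    (hc : HasCompactSupport φ) : Integrable (fun x => f x * φ x) :=
  (Lp.memLp f).integrable_mul (hφ.memLp_of_hasCompactSupport (p := 2) hc)

theorem HasWeakDeriv.zero : HasWeakDeriv 0 0 := by
  intro φ _ _
  have h (ψ : ℝ → ℂ) : ∫ x, (0 : L2) x * ψ x = 0 := by
    rw [← integral_zero ℝ ℂ]
    refine integral_congr_ae ?_
    filter_upwards [Lp.coeFn_zero ℂ 2 (volume : Measure ℝ)] with x hx
    rw [hx]; simp
  rw [h, h, neg_zero]

theorem HasWeakDeriv.add {f g f' g' : L2} (h : HasWeakDeriv f g) (h' : HasWeakDeriv f' g') :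
    HasWeakDeriv (f + f') (g + g') := by
  intro φ hφ hc
  have key (a b : L2) {ψ : ℝ → ℂ} (hψ : Continuous ψ) (hs : HasCompactSupport ψ) :
      ∫ x, (a + b : L2) x * ψ x = (∫ x, a x * ψ x) + ∫ x, b x * ψ x := by
    rw [← integral_add (integrable_mul_test a hψ hs) (integrable_mul_test b hψ hs)]
    refine integral_congr_ae ?_
    filter_upwards [Lp.coeFn_add a b] with x hx
    rw [hx, Pi.add_apply, add_mul]
  rw [key f f' (hφ.continuous_deriv (by simp)) hc.deriv, key g g' hφ.continuous hc,
    h φ hφ hc, h' φ hφ hc, neg_add]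

theorem HasWeakDeriv.smul {f g : L2} (c : ℂ) (h : HasWeakDeriv f g) :
    HasWeakDeriv (c • f) (c • g) := by
  intro φ hφ hc
  have key (a : L2) (ψ : ℝ → ℂ) : ∫ x, (c • a : L2) x * ψ x = c * ∫ x, a x * ψ x := by
    rw [← integral_const_mul]
    refine integral_congr_ae ?_
    filter_upwards [Lp.coeFn_smul c a] with x hx
    rw [hx, Pi.smul_apply, smul_eq_mul, mul_assoc]
  rw [key, key, h φ hφ hc, mul_neg]

/-- The pairs `(f, g)` in `L²(ℝ) × L²(ℝ)` such that `g` is the weak derivative of `f`. -/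
def weakDerivGraph : Submodule ℂ (WithLp 2 (L2 × L2)) where
  carrier := {p | HasWeakDeriv p.fst p.snd}
  zero_mem' := HasWeakDeriv.zero
  add_mem' h h' := HasWeakDeriv.add h h'
  smul_mem' c _ h := HasWeakDeriv.smul c h

/-- The Sobolev space `H¹(ℝ)` of complex-valued functions, realised as the space of the pairs
`(f, f')` with `f ∈ L²(ℝ)` whose weak derivative `f'` also lies in `L²(ℝ)`. The norm inherited
from the ambient Hilbert space is `(‖f‖² + ‖f'‖²)^(1/2)`, with the `L²(ℝ)` norms. -/
abbrev H1 : Type := weakDerivGraph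

/-- The function in `L²(ℝ)` underlying an element of `H¹(ℝ)`. -/
def H1.toL2 (f : H1) : L2 := f.1.fst

/-- The weak derivative `f_x` in `L²(ℝ)` of an element `f` of `H¹(ℝ)`. -/
def H1.dx (f : H1) : L2 := f.1.snd

/-- The Wirtinger derivative `∂g/∂z̄ = (∂g/∂x + i ∂g/∂y) / 2`, where `z = x + i y`, of a
real-valued function `g` on the complex plane. -/
def wirtingerBar (g : ℂ → ℝ) (z : ℂ) : ℂ :=
  (1 / 2 : ℂ) * ((fderiv ℝ g z 1 : ℂ) + Complex.I * (fderiv ℝ g z Complex.I : ℂ))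

/-- `W` is a (real-valued) polynomial in the two variables `|u|²` and `|v|²`. -/
def IsPolynomialInModuli (W : ℂ → ℂ → ℝ) : Prop :=
  ∃ P : MvPolynomial (Fin 2) ℝ, ∀ u v : ℂ, W u v = MvPolynomial.eval ![‖u‖ ^ 2, ‖v‖ ^ 2] P

/-- `t ↦ w t = (u t, v t)` is a solution in `C(J, H¹(ℝ))` of the nonlinear Dirac equations

* `i (u_t + u_x) + v = ∂W/∂ū (u, v)`,
* `i (v_t - v_x) + u = ∂W/∂v̄ (u, v)`

on the time interval `J`. The time derivatives `u_t`, `v_t` are derivatives of `L²(ℝ)`-valued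
functions (one-sided at the end points that belong to `J`), and the equations hold
in `L²(ℝ)`, that is, almost everywhere on the line, at each time of `J`. -/
structure IsDiracSolutionOn (W : ℂ → ℂ → ℝ) (J : Set ℝ) (w : ℝ → H1 × H1) : Prop where
  continuousOn : ContinuousOn w J
  equation : ∀ t ∈ J, ∃ ut vt : L2,
    HasDerivWithinAt (fun s => (w s).1.toL2) ut J t ∧
    HasDerivWithinAt (fun s => (w s).2.toL2) vt J t ∧
    (∀ᵐ x : ℝ, Complex.I * (ut x + (w t).1.dx x) + (w t).2.toL2 x =
      wirtingerBar (fun z => W z ((w t).2.toL2 x)) ((w t).1.toL2 x)) ∧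
    (∀ᵐ x : ℝ, Complex.I * (vt x - (w t).2.dx x) + (w t).1.toL2 x =
      wirtingerBar (fun z => W ((w t).1.toL2 x) z) ((w t).2.toL2 x))

end DiracH1

end

/-!
The free part of the equations is transport along the characteristics `x ± t`, which acts
isometrically on `H¹(ℝ) × H¹(ℝ)` (`evol`). Writing `w t = evol t (z t)` turns the Dirac equations
into an ordinary differential equation `z' = interaction N t z` in the Hilbert space
`H¹(ℝ) × H¹(ℝ)`, where the unbounded operator `∂ₓ` no longer appears
(`IsDiracSolutionOn.hasDerivWithinAt_evol`, `isDiracSolutionOn_evol`). As `H¹(ℝ)` is an algebra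
of bounded continuous functions (`toBCF`, `mulH`), the nonlinearity is Lipschitz on bounded sets,
and uniqueness is that of ordinary differential equations.

Global existence rests on an a priori bound. Since `∂W/∂ū` and `∂W/∂v̄` are real multiples of `u`
and `v`, they drop out of the growth rate of `|u|²` and `|v|²` along characteristics, which is
therefore at most `2 |u| |v|`; by Gronwall the supremum norm grows at most like `e^|t|`
(`norm_bcfPair_le_mul_exp`). The tame product estimate `norm_mulH_le` bounds the `H¹` norm of the
nonlinearity linearly in the `H¹` norm of `w`, with a constant depending on the supremum norm only
(`IsTame.linear_bound`), so a second application of Gronwall bounds the `H¹` norm on bounded time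
intervals.

The continuation argument is replaced by a truncation: the nonlinearity is composed with the radial
retraction onto a large ball, which makes it bounded and globally Lipschitz, so that the
Picard–Lindelöf theorem applies on any bounded time interval. The retraction only rescales `(u, v)`,
so the a priori bounds hold uniformly in the radius of the ball
(`IsDiracField.norm_le_of_truncated`), and for a large radius the truncation is never reached.
-/

noncomputable section

namespace DiracH1

open Filter Topology
open scoped NNReal

/-! ### Translations and weak derivatives in `L²(ℝ)` -/

/-- The translation `f ↦ f (· + s)` on `L²(ℝ)`. -/
def shift (s : ℝ) : L2 →ₗᵢ[ℂ] L2 :=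
  Lp.compMeasurePreservingₗᵢ ℂ (fun x => x + s) (measurePreserving_add_right volume s)

theorem shift_ae (s : ℝ) (f : L2) : ∀ᵐ x, shift s f x = f (x + s) :=
  Lp.coeFn_compMeasurePreserving f (measurePreserving_add_right volume s)

theorem ae_comp_add {p : ℝ → Prop} (h : ∀ᵐ x, p x) (s : ℝ) : ∀ᵐ x, p (x + s) :=
  (measurePreserving_add_right volume s).quasiMeasurePreserving.ae h

theorem shift_shift (s t : ℝ) (f : L2) : shift s (shift t f) = shift (s + t) f := by
  apply Lp.ext
  filter_upwards [shift_ae s (shift t f), shift_ae (s + t) f, ae_comp_add (shift_ae t f) s]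
    with x h1 h2 h3
  rw [h1, h2, h3, add_assoc]

theorem shift_zero (f : L2) : shift 0 f = f := by
  apply Lp.ext
  filter_upwards [shift_ae 0 f] with x h1
  rw [h1, add_zero]

theorem tendsto_shift {α : Type*} {l : Filter α} {s : α → ℝ} {f : α → L2} {s₀ : ℝ} {f₀ : L2}
    (hs : Tendsto s l (𝓝 s₀)) (hf : Tendsto f l (𝓝 f₀)) :
    Tendsto (fun a => shift (s a) (f a)) l (𝓝 (shift s₀ f₀)) := by
  let g : ℝ → C(ℝ, ℝ) := ContinuousMap.curry
    ⟨fun p : ℝ × ℝ => p.2 + p.1, by fun_prop⟩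
  have hg : Continuous g := ContinuousMap.continuous _
  exact hf.compMeasurePreservingLp ((hg.tendsto s₀).comp hs)
    (fun a => measurePreserving_add_right volume (s a))
    (measurePreserving_add_right volume s₀) (by norm_num)

theorem continuous_shift : Continuous fun p : ℝ × L2 => shift p.1 p.2 :=
  continuous_iff_continuousAt.2 fun _ => tendsto_shift continuousAt_fst continuousAt_snd

/-- The bounded linear functional `f ↦ ∫ f φ` on `L²(ℝ)`. -/
def pairing (φ : ℝ → ℂ) (hφ : MemLp φ 2 volume) : L2 →L[ℂ] ℂ :=
  innerSL ℂ (MemLp.toLp _ hφ.star)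

theorem pairing_apply {φ : ℝ → ℂ} (hφ : MemLp φ 2 volume) (f : L2) :
    pairing φ hφ f = ∫ x, f x * φ x := by
  rw [pairing, innerSL_apply_apply, L2.inner_def]
  refine integral_congr_ae ?_
  filter_upwards [MemLp.coeFn_toLp hφ.star] with x hx
  rw [hx]
  simp [RCLike.inner_apply]

theorem memLp_test {φ : ℝ → ℂ} (hφ : ContDiff ℝ ∞ φ) (hc : HasCompactSupport φ) :
    MemLp φ 2 volume :=
  hφ.continuous.memLp_of_hasCompactSupport hc

theorem contDiff_deriv_test {φ : ℝ → ℂ} (hφ : ContDiff ℝ ∞ φ) : ContDiff ℝ ∞ (deriv φ) :=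
  ((contDiff_succ_iff_deriv (n := ∞)).1 hφ).2.2

theorem locallyIntegrable (f : L2) : LocallyIntegrable (fun x => f x) volume :=
  (Lp.memLp f).locallyIntegrable (by norm_num)

/-- An element of `L²(ℝ)` that is orthogonal to all test functions vanishes. -/
theorem eq_zero_of_pairing {f : L2}
    (h : ∀ φ : ℝ → ℂ, ContDiff ℝ ∞ φ → HasCompactSupport φ → ∫ x, f x * φ x = 0) : f = 0 := by
  apply Lp.ext
  have := ae_eq_zero_of_integral_contDiff_smul_eq_zero (locallyIntegrable f) (fun g hg hc => by
    have := h (fun x => (g x : ℂ)) (Complex.ofRealCLM.contDiff.comp hg)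
      (hc.comp_left (g := fun x : ℝ => (x : ℂ)) Complex.ofReal_zero)
    rw [← this]
    exact integral_congr_ae (.of_forall fun x => by simp [mul_comm]))
  filter_upwards [this, Lp.coeFn_zero ℂ 2 (volume : Measure ℝ)] with x h1 h2
  rw [h1, h2]; rfl

/-- Moving a translation onto the test function makes the pairing differentiable. -/
theorem hasDerivAt_pairing_shift (f : L2) {φ : ℝ → ℂ} (hφ : ContDiff ℝ ∞ φ)
    (hc : HasCompactSupport φ) (h : ℝ) :
    HasDerivAt (fun s => ∫ x, shift s f x * φ x) (- ∫ x, shift h f x * deriv φ x) h := by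
  have key (ψ : ℝ → ℂ) (s : ℝ) : ∫ x, shift s f x * ψ x =
      convolution (fun x => f x) (fun x => ψ (-x)) (ContinuousLinearMap.mul ℝ ℂ) volume s := by
    rw [convolution]
    rw [← integral_add_right_eq_self
      (fun t => ContinuousLinearMap.mul ℝ ℂ (f t) (ψ (-(s - t)))) s]
    refine integral_congr_ae ?_
    filter_upwards [shift_ae s f] with x hx
    simp [hx]
  have hd : deriv (fun x => φ (-x)) = fun x => - (deriv φ) (-x) := by
    ext x; exact deriv_comp_neg φ x
  have h1 := HasCompactSupport.hasDerivAt_convolution_right (ContinuousLinearMap.mul ℝ ℂ)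
    (locallyIntegrable f) (g₀ := fun x => φ (-x))
    (hc.comp_homeomorph (Homeomorph.neg ℝ)) ((hφ.comp contDiff_neg).of_le (by norm_cast)) h
  rw [hd] at h1
  simp_rw [key]
  refine h1.congr_deriv ?_
  simp [convolution, integral_neg]

theorem HasWeakDeriv.shift {f g : L2} (h : HasWeakDeriv f g) (s : ℝ) :
    HasWeakDeriv (shift s f) (shift s g) := by
  intro φ hφ hc
  have key (a : L2) (ψ : ℝ → ℂ) : ∫ x, DiracH1.shift s a x * ψ x = ∫ x, a x * ψ (x - s) := by
    rw [← integral_add_right_eq_self (fun x => a x * ψ (x - s)) s]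
    refine integral_congr_ae ?_
    filter_upwards [shift_ae s a] with x hx
    simp [hx]
  have h1 := h (fun x => φ (x - s)) (hφ.comp (contDiff_id.sub contDiff_const))
    (hc.comp_homeomorph (Homeomorph.subRight s))
  rw [key, key, ← h1]
  refine integral_congr_ae (.of_forall fun x => ?_)
  simp only
  rw [deriv_comp_sub_const]

/-- A weakly differentiable function is differentiated in `L²(ℝ)` by the translation group:
`f (· + h) - f` and the Bochner integral `∫₀ʰ g (· + s) ds` have the same pairing with every test
function. -/
theorem HasWeakDeriv.hasDerivAt_shift {f g : L2} (hfg : HasWeakDeriv f g) (h : ℝ) :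
    HasDerivAt (fun s => DiracH1.shift s f) (DiracH1.shift h g) h := by
  have hcont : Continuous fun s => DiracH1.shift s g :=
    continuous_shift.comp (by fun_prop : Continuous fun s : ℝ => (s, g))
  have hd (t : ℝ) : HasDerivAt (fun t => ∫ s in (0 : ℝ)..t, DiracH1.shift s g)
      (DiracH1.shift t g) t :=
    intervalIntegral.integral_hasDerivAt_right (hcont.intervalIntegrable _ _)
      (hcont.stronglyMeasurableAtFilter _ _) hcont.continuousAt
  have heq : (fun s => DiracH1.shift s f) =
      fun t => f + ∫ s in (0 : ℝ)..t, DiracH1.shift s g := by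
    ext1 t
    rw [← sub_eq_zero]
    apply eq_zero_of_pairing
    intro φ hφ hc
    have hm := memLp_test hφ hc
    rw [← pairing_apply hm, map_sub, sub_eq_zero]
    have hD (s : ℝ) : HasDerivAt (fun s => pairing φ hm (DiracH1.shift s f) -
        pairing φ hm (f + ∫ r in (0 : ℝ)..s, DiracH1.shift r g)) 0 s := by
      have h1 := hasDerivAt_pairing_shift f hφ hc s
      rw [hfg.shift s φ hφ hc, neg_neg] at h1
      simp_rw [← pairing_apply hm] at h1
      have h2 := ((pairing φ hm).restrictScalars ℝ).hasFDerivAt.comp_hasDerivAt s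
        ((hd s).const_add f)
      rw [← sub_self (pairing φ hm (DiracH1.shift s g))]
      exact h1.sub h2
    have := is_const_of_deriv_eq_zero (fun s => (hD s).differentiableAt)
      (fun s => (hD s).deriv) t 0
    simp only [shift_zero, intervalIntegral.integral_same, add_zero, sub_self] at this
    exact sub_eq_zero.1 this
  rw [heq]
  exact (hd h).const_add f

/-- Conversely, the `L²(ℝ)` derivative along the translation group is a weak derivative. -/
theorem hasWeakDeriv_of_hasDerivAt_shift {f g : L2}
    (h : HasDerivAt (fun s => shift s f) g 0) : HasWeakDeriv f g := by
  intro φ hφ hc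
  have hm := memLp_test hφ hc
  have h1 := hasDerivAt_pairing_shift f hφ hc 0
  have h2 := ((pairing φ hm).restrictScalars ℝ).hasFDerivAt.comp_hasDerivAt 0 h
  simp_rw [← pairing_apply hm] at h1
  have := h1.unique h2
  rw [shift_zero] at this
  rw [← pairing_apply hm, ← neg_eq_iff_eq_neg]
  exact this

/-- Differentiation of a curve in `L²(ℝ)` seen from a moving frame: if `f t` has weak derivative
`g`, then `s ↦ f s (· + σ s)` has derivative `(f' + σ g) (· + σ t)` at `t`. -/
theorem hasDerivWithinAt_shift {f : ℝ → L2} {f' g : L2} {σ t : ℝ} {J : Set ℝ}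
    (hf : HasDerivWithinAt f f' J t) (hg : HasWeakDeriv (f t) g) :
    HasDerivWithinAt (fun s => shift (σ * s) (f s)) (shift (σ * t) (f' + σ • g)) J t := by
  have h1 : HasDerivWithinAt (fun s => shift (σ * s) (f t)) (σ • shift (σ * t) g) J t := by
    have := (hg.hasDerivAt_shift (σ * t)).scomp t ((hasDerivAt_id t).const_mul σ)
    simpa [Function.comp_def] using this.hasDerivWithinAt
  have h2 : HasDerivWithinAt (fun s => shift (σ * s) (f s - f t)) (shift (σ * t) f') J t := by
    rw [hasDerivWithinAt_iff_tendsto_slope] at hf ⊢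
    have hs : Tendsto (fun s => σ * s) (𝓝[J \ {t}] t) (𝓝 (σ * t)) :=
      ((continuous_const.mul continuous_id).tendsto t).mono_left nhdsWithin_le_nhds
    refine (tendsto_shift hs hf).congr fun s => ?_
    simp only [slope, vsub_eq_sub, sub_self, map_zero, sub_zero]
    exact LinearMap.map_smul_of_tower (shift (σ * s)).toLinearMap _ _
  have h3 := h2.add h1
  have e : shift (σ * t) f' + σ • shift (σ * t) g = shift (σ * t) (f' + σ • g) := by
    rw [map_add]
    congr 1
    exact (LinearMap.map_smul_of_tower (shift (σ * t)).toLinearMap _ _).symm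
  rw [e] at h3
  refine h3.congr_of_eventuallyEq (.of_forall fun s => ?_) ?_ <;> simp

theorem isClosed_weakDerivGraph : IsClosed (weakDerivGraph : Set (WithLp 2 (L2 × L2))) := by
  have : (weakDerivGraph : Set (WithLp 2 (L2 × L2))) = {p | HasWeakDeriv p.fst p.snd} := rfl
  rw [this]
  simp only [HasWeakDeriv, ofPred_forall]
  refine isClosed_iInter fun φ => isClosed_iInter fun hφ => isClosed_iInter fun hc => ?_
  have hm := memLp_test hφ hc
  have hm' := memLp_test (contDiff_deriv_test hφ) hc.deriv
  simp_rw [← pairing_apply hm, ← pairing_apply hm']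
  refine isClosed_eq ?_ ?_
  · exact (pairing _ hm').continuous.comp (WithLp.fstL 2 ℂ L2 L2).continuous
  · exact ((pairing _ hm).continuous.comp (WithLp.sndL 2 ℂ L2 L2).continuous).neg

instance : CompleteSpace H1 := isClosed_weakDerivGraph.completeSpace_coe

/-! ### The continuous representative of a function in `H¹(ℝ)` -/

theorem intervalIntegrable (f : L2) (a b : ℝ) : IntervalIntegrable (fun x => f x) volume a b :=
  ((locallyIntegrable f).integrableOn_isCompact isCompact_uIcc).intervalIntegrable

theorem integral_norm_le (f : L2) {a b : ℝ} (hab : a ≤ b) :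
    ∫ t in a..b, ‖f t‖ ≤ √(b - a) * ‖f‖ := by
  have hm : MemLp (fun t => ‖f t‖) 2 volume := (Lp.memLp f).norm
  let F : Lp ℝ 2 (volume : Measure ℝ) := hm.toLp
  have h1 := L2.inner_indicatorConstLp_one (𝕜 := ℝ) (μ := (volume : Measure ℝ))
    (measurableSet_Ioc (a := a) (b := b)) (by simp) F
  have h2 : ∫ t in Ioc a b, F t = ∫ t in a..b, ‖f t‖ := by
    rw [intervalIntegral.integral_of_le hab]
    exact integral_congr_ae (ae_restrict_of_ae hm.coeFn_toLp)
  rw [← h2, ← h1]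
  refine (real_inner_le_norm _ _).trans (le_of_eq ?_)
  have h3 : ‖F‖ = ‖f‖ := by
    rw [Lp.norm_toLp, Lp.norm_def, eLpNorm_norm]
  rw [h3, norm_indicatorConstLp (by norm_num) (by norm_num)]
  simp [hab, Real.sqrt_eq_rpow]

theorem norm_integral_le (f : L2) (a b : ℝ) :
    ‖∫ t in a..b, f t‖ ≤ √|b - a| * ‖f‖ := by
  wlog hab : a ≤ b generalizing a b
  · rw [intervalIntegral.integral_symm, norm_neg, abs_sub_comm]
    exact this b a (le_of_not_ge hab)
  rw [abs_of_nonneg (sub_nonneg.2 hab)]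
  exact (intervalIntegral.norm_integral_le_integral_norm hab).trans (integral_norm_le f hab)

theorem continuous_integral (g : L2) : Continuous fun x => ∫ t in (0 : ℝ)..x, g t :=
  intervalIntegral.continuous_primitive (fun a b => intervalIntegrable g a b) 0

/-- Integration by parts against a test function for the primitive of a function in `L²(ℝ)`. Both
sides are continuous in `g`, so it suffices to treat continuous functions. -/
theorem integral_primitive_mul_deriv (g : L2) {φ : ℝ → ℂ} (hφ : ContDiff ℝ ∞ φ)
    (hc : HasCompactSupport φ) :
    ∫ x, (∫ t in (0 : ℝ)..x, g t) * deriv φ x = - ∫ x, g x * φ x := by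
  have hφ' := hφ.continuous_deriv (by simp)
  have hint {u : ℝ → ℂ} (hu : Continuous u) : Integrable (fun x => u x * deriv φ x) :=
    (hu.mul hφ').integrable_of_hasCompactSupport hc.deriv.mul_left
  have hm := memLp_test hφ hc
  let C : ℝ := ∫ x, √|x - 0| * ‖deriv φ x‖
  have hbd (g : L2) : ‖∫ x, (∫ t in (0 : ℝ)..x, g t) * deriv φ x‖ ≤ C * ‖g‖ := by
    rw [← integral_mul_const]
    refine norm_integral_le_of_norm_le ?_ (.of_forall fun x => ?_)
    · refine Integrable.mul_const ?_ _
      exact Continuous.integrable_of_hasCompactSupport (by fun_prop) hc.deriv.norm.mul_left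
    · rw [norm_mul, mul_right_comm]
      exact mul_le_mul_of_nonneg_right (norm_integral_le g 0 x) (norm_nonneg _)
  let Φ : L2 →L[ℂ] ℂ := LinearMap.mkContinuous
    { toFun := fun g => ∫ x, (∫ t in (0 : ℝ)..x, g t) * deriv φ x
      map_add' := fun g h => by
        rw [← integral_add (hint (continuous_integral g)) (hint (continuous_integral h))]
        refine integral_congr_ae (.of_forall fun x => ?_)
        simp only
        rw [← add_mul, ← intervalIntegral.integral_add (intervalIntegrable g _ _)
          (intervalIntegrable h _ _)]
        congr 1
        refine intervalIntegral.integral_congr_ae ?_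
        filter_upwards [Lp.coeFn_add g h] with t ht _
        rw [ht, Pi.add_apply]
      map_smul' := fun c g => by
        rw [RingHom.id_apply, smul_eq_mul, ← integral_const_mul]
        refine integral_congr_ae (.of_forall fun x => ?_)
        simp only
        rw [← mul_assoc, ← intervalIntegral.integral_const_mul]
        congr 1
        refine intervalIntegral.integral_congr_ae ?_
        filter_upwards [Lp.coeFn_smul c g] with t ht _
        rw [ht, Pi.smul_apply, smul_eq_mul] } C hbd
  let D : L2 →L[ℂ] ℂ := Φ + pairing φ hm
  suffices hD : D g = 0 by
    rw [← pairing_apply hm]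
    exact eq_neg_of_add_eq_zero_left hD
  -- For continuous `h` the primitive is differentiable and the classical formula applies.
  have hD0 {h : ℝ → ℂ} (hh : Continuous h) (hhm : MemLp h 2 volume) : D hhm.toLp = 0 := by
    let H : L2 := hhm.toLp
    change (∫ x, (∫ t in (0 : ℝ)..x, H t) * deriv φ x) + pairing φ hm H = 0
    have e1 : ∫ x, H x * φ x = ∫ x, h x * φ x := by
      refine integral_congr_ae ?_
      filter_upwards [hhm.coeFn_toLp] with x hx
      rw [hx]
    have e2 (x : ℝ) : ∫ t in (0 : ℝ)..x, H t = ∫ t in (0 : ℝ)..x, h t := by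
      refine intervalIntegral.integral_congr_ae ?_
      filter_upwards [hhm.coeFn_toLp] with x hx _
      rw [hx]
    have hd (x : ℝ) : HasDerivAt (fun x => ∫ t in (0 : ℝ)..x, h t) (h x) x :=
      intervalIntegral.integral_hasDerivAt_right (hh.intervalIntegrable _ _)
        (hh.stronglyMeasurableAtFilter _ _) hh.continuousAt
    have hcont : Continuous (fun x => ∫ t in (0 : ℝ)..x, h t) :=
      continuous_iff_continuousAt.2 fun x => (hd x).continuousAt
    rw [pairing_apply, e1]
    simp_rw [e2]
    rw [integral_mul_deriv_eq_deriv_mul_of_integrable (fun x _ => hd x)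
      (fun x _ => (hφ.differentiable (by simp) x).hasDerivAt) (hint hcont)
      ((hh.mul hφ.continuous).integrable_of_hasCompactSupport hc.mul_left)
      ((hcont.mul hφ.continuous).integrable_of_hasCompactSupport hc.mul_left),
      neg_add_cancel]
  rw [← norm_le_zero_iff]
  refine le_of_forall_pos_le_add fun ε hε => ?_
  obtain ⟨h, -, hle, hh, hhm⟩ := (Lp.memLp g).exists_hasCompactSupport_eLpNorm_sub_le
    (by norm_num) (ε := ENNReal.ofReal (ε / (‖D‖ + 1))) (by
      have : 0 < ε / (‖D‖ + 1) := by positivity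
      simpa using this)
  have h1 : ‖g - hhm.toLp‖ ≤ ε / (‖D‖ + 1) := by
    have : g - hhm.toLp = ((Lp.memLp g).sub hhm).toLp := by
      rw [MemLp.toLp_sub (Lp.memLp g) hhm, Lp.toLp_coeFn]
    rw [this, Lp.norm_toLp]
    exact ENNReal.toReal_le_of_le_ofReal (by positivity) hle
  calc ‖D g‖ = ‖D (g - hhm.toLp)‖ := by rw [map_sub, hD0 hh, sub_zero]
    _ ≤ ‖D‖ * (ε / (‖D‖ + 1)) := D.le_opNorm_of_le h1
    _ ≤ (‖D‖ + 1) * (ε / (‖D‖ + 1)) := by gcongr; linarith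
    _ = 0 + ε := by rw [zero_add]; field_simp

/-- A test function with vanishing integral is the derivative of a test function. -/
theorem exists_test_deriv_eq {θ : ℝ → ℂ} (hθ : ContDiff ℝ ∞ θ) (hc : HasCompactSupport θ)
    (h0 : ∫ x, θ x = 0) :
    ∃ φ : ℝ → ℂ, ContDiff ℝ ∞ φ ∧ HasCompactSupport φ ∧ deriv φ = θ := by
  obtain ⟨R, -, hR⟩ := hc.exists_pos_le_norm
  have hd (x : ℝ) : HasDerivAt (fun x => ∫ t in (-R)..x, θ t) (θ x) x :=
    intervalIntegral.integral_hasDerivAt_right (hθ.continuous.intervalIntegrable _ _)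
      (hθ.continuous.stronglyMeasurableAtFilter _ _) hθ.continuous.continuousAt
  have hderiv : deriv (fun x => ∫ t in (-R)..x, θ t) = θ := funext fun x => (hd x).deriv
  refine ⟨fun x => ∫ t in (-R)..x, θ t, ?_, ?_, hderiv⟩
  · rw [contDiff_infty_iff_deriv, hderiv]
    exact ⟨fun x => (hd x).differentiableAt, hθ⟩
  · refine HasCompactSupport.intro (isCompact_Icc (a := -R) (b := R)) fun x hx => ?_
    rcases lt_or_ge x (-R) with h | h
    · refine (intervalIntegral.integral_congr fun t ht => ?_).trans
        intervalIntegral.integral_zero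
      rw [uIcc_of_ge h.le] at ht
      exact hR t (le_abs.2 (Or.inr (by linarith [ht.2])))
    · have hx' : R < x := by
        by_contra h'
        exact hx ⟨h, not_lt.1 h'⟩
      rw [intervalIntegral.integral_eq_integral_of_support_subset, h0]
      intro t ht
      have ht' : |t| < R := by
        by_contra h'
        exact ht (hR t (not_lt.1 h'))
      exact ⟨(abs_lt.1 ht').1, ((abs_lt.1 ht').2.trans hx').le⟩

/-- A function with a weak derivative in `L²(ℝ)` is, almost everywhere, a primitive of it
(the du Bois-Reymond lemma). -/
theorem HasWeakDeriv.exists_primitive {f g : L2} (h : HasWeakDeriv f g) :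
    ∃ c : ℂ, ∀ᵐ x, f x = c + ∫ t in (0 : ℝ)..x, g t := by
  let k : ℝ → ℂ := fun x => f x - ∫ t in (0 : ℝ)..x, g t
  have hk : LocallyIntegrable k volume :=
    (locallyIntegrable f).sub (continuous_integral g).locallyIntegrable
  have hint {ψ : ℝ → ℂ} (hψ : Continuous ψ) (hc : HasCompactSupport ψ) :
      Integrable (fun x => k x * ψ x) := by
    simpa [mul_comm] using hk.integrable_smul_left_of_hasCompactSupport hψ hc
  have hk0 {φ : ℝ → ℂ} (hφ : ContDiff ℝ ∞ φ) (hc : HasCompactSupport φ) :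
      ∫ x, k x * deriv φ x = 0 := by
    have hi : Integrable fun x => (∫ t in (0 : ℝ)..x, g t) * deriv φ x :=
      ((continuous_integral g).mul
        (hφ.continuous_deriv (by simp))).integrable_of_hasCompactSupport hc.deriv.mul_left
    simp only [k, sub_mul]
    rw [integral_sub (integrable_mul_test f (hφ.continuous_deriv (by simp)) hc.deriv) hi,
      h φ hφ hc, integral_primitive_mul_deriv g hφ hc, sub_self]
  obtain ⟨ρ, hρ, hρc, hρ1⟩ : ∃ ρ : ℝ → ℂ, ContDiff ℝ ∞ ρ ∧ HasCompactSupport ρ ∧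
      ∫ x, ρ x = 1 := by
    let b : ContDiffBump (0 : ℝ) := ⟨1, 2, one_pos, one_lt_two⟩
    refine ⟨fun x => (b.normed volume x : ℂ), Complex.ofRealCLM.contDiff.comp b.contDiff_normed,
      b.hasCompactSupport_normed.comp_left (g := fun x : ℝ => (x : ℂ)) Complex.ofReal_zero, ?_⟩
    rw [integral_complex_ofReal, b.integral_normed, Complex.ofReal_one]
  -- `k` annihilates all derivatives of test functions, in particular `ψ - (∫ ψ) ρ`.
  refine ⟨∫ x, k x * ρ x, ?_⟩
  have := ae_eq_of_integral_contDiff_smul_eq hk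
    (continuous_const (y := ∫ x, k x * ρ x)).locallyIntegrable (fun ψ hψ hc => ?_)
  · filter_upwards [this] with x hx
    rw [← hx, sub_add_cancel]
  have hψ' : ContDiff ℝ ∞ fun x => (ψ x : ℂ) := Complex.ofRealCLM.contDiff.comp hψ
  have hc' : HasCompactSupport fun x => (ψ x : ℂ) :=
    hc.comp_left (g := fun x : ℝ => (x : ℂ)) Complex.ofReal_zero
  let I : ℂ := ∫ x, (ψ x : ℂ)
  obtain ⟨φ, hφ, hφc, hφ'⟩ := exists_test_deriv_eq (θ := fun x => (ψ x : ℂ) - I * ρ x)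
    (hψ'.sub (contDiff_const.mul hρ)) (hc'.sub hρc.mul_left) (by
      rw [integral_sub (hψ'.continuous.integrable_of_hasCompactSupport hc')
        ((hρ.continuous.integrable_of_hasCompactSupport hρc).const_mul _), integral_const_mul,
        hρ1, mul_one, sub_self])
  have h1 := hk0 hφ hφc
  rw [hφ'] at h1
  have e (x : ℝ) : k x * ((ψ x : ℂ) - I * ρ x) = k x * (ψ x : ℂ) - I * (k x * ρ x) := by ring
  simp_rw [e] at h1
  rw [integral_sub (hint hψ'.continuous hc') ((hint hρ.continuous hρc).const_mul _),
    integral_const_mul, sub_eq_zero] at h1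
  simp_rw [Complex.real_smul]
  rw [integral_mul_const, ← h1]
  exact integral_congr_ae (.of_forall fun x => mul_comm _ _)

theorem H1.hasWeakDeriv (f : H1) : HasWeakDeriv f.toL2 f.dx := f.2

/-- Existence of the bounded continuous representative. For the bound, average
`|F x| ≤ |F y| + ‖f'‖` over `y ∈ [x, x + 1]`. -/
theorem H1.exists_continuous (f : H1) : ∃ F : BoundedContinuousFunction ℝ ℂ,
    (∀ᵐ x, f.toL2 x = F x) ∧ ‖F‖ ≤ ‖f.toL2‖ + ‖f.dx‖ := by
  obtain ⟨c, hF⟩ := f.hasWeakDeriv.exists_primitive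
  set F : ℝ → ℂ := fun x => c + ∫ t in (0 : ℝ)..x, f.dx t with hFdef
  have hcont : Continuous F := continuous_const.add (continuous_integral f.dx)
  have hbd (x : ℝ) : ‖F x‖ ≤ ‖f.toL2‖ + ‖f.dx‖ := by
    have h1 (y : ℝ) (hy : y ∈ Icc x (x + 1)) : ‖F x‖ ≤ ‖F y‖ + ‖f.dx‖ := by
      have e : F x = F y - ∫ t in x..y, f.dx t := by
        rw [hFdef]
        simp only
        rw [← intervalIntegral.integral_interval_sub_left (intervalIntegrable f.dx 0 y)
          (intervalIntegrable f.dx 0 x)]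
        ring
      rw [e]
      refine (norm_sub_le _ _).trans ?_
      gcongr
      refine (norm_integral_le _ _ _).trans (mul_le_of_le_one_left (norm_nonneg _) ?_)
      rw [Real.sqrt_le_one, abs_of_nonneg (by linarith [hy.1])]
      linarith [hy.2]
    calc ‖F x‖ = ∫ _ in x..(x + 1), ‖F x‖ := by simp
      _ ≤ ∫ y in x..(x + 1), (‖F y‖ + ‖f.dx‖) :=
        intervalIntegral.integral_mono_on (by linarith) (by simp)
          (Continuous.intervalIntegrable (by fun_prop) _ _) h1
      _ = (∫ y in x..(x + 1), ‖f.toL2 y‖) + ‖f.dx‖ := by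
        rw [intervalIntegral.integral_add (Continuous.intervalIntegrable (by fun_prop) _ _)
          (by simp)]
        congr 1
        · refine intervalIntegral.integral_congr_ae ?_
          filter_upwards [hF] with y hy _
          rw [hy]
        · simp
      _ ≤ ‖f.toL2‖ + ‖f.dx‖ := by
        gcongr
        simpa using integral_norm_le f.toL2 (a := x) (b := x + 1) (by linarith)
  exact ⟨BoundedContinuousFunction.ofNormedAddCommGroup F hcont _ hbd, hF,
    BoundedContinuousFunction.norm_ofNormedAddCommGroup_le _ (by positivity) hbd⟩

theorem bcf_ext {F G : BoundedContinuousFunction ℝ ℂ} (h : ∀ᵐ x, F x = G x) : F = G :=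
  DFunLike.coe_injective ((F.continuous.ae_eq_iff_eq volume G.continuous).1 h)

theorem H1.norm_sq_eq (f : H1) : ‖f‖ ^ 2 = ‖f.toL2‖ ^ 2 + ‖f.dx‖ ^ 2 :=
  WithLp.prod_norm_sq_eq_of_L2 f.1

theorem H1.norm_toL2_le (f : H1) : ‖f.toL2‖ ≤ ‖f‖ :=
  le_of_sq_le_sq (by rw [f.norm_sq_eq]; nlinarith [sq_nonneg ‖f.dx‖]) (norm_nonneg _)

theorem H1.norm_dx_le (f : H1) : ‖f.dx‖ ≤ ‖f‖ :=
  le_of_sq_le_sq (by rw [f.norm_sq_eq]; nlinarith [sq_nonneg ‖f.toL2‖]) (norm_nonneg _)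

theorem H1.norm_le (f : H1) : ‖f‖ ≤ ‖f.toL2‖ + ‖f.dx‖ :=
  le_of_sq_le_sq (by
    rw [f.norm_sq_eq]
    nlinarith [mul_nonneg (norm_nonneg f.toL2) (norm_nonneg f.dx)]) (by positivity)

/-- The embedding `H¹(ℝ) → L²(ℝ)`. -/
def toL2L : H1 →L[ℂ] L2 := (WithLp.fstL 2 ℂ L2 L2).comp weakDerivGraph.subtypeL

/-- The weak derivative as a bounded operator `H¹(ℝ) → L²(ℝ)`. -/
def dxL : H1 →L[ℂ] L2 := (WithLp.sndL 2 ℂ L2 L2).comp weakDerivGraph.subtypeL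

/-- The Sobolev embedding of `H¹(ℝ)` into the bounded continuous functions, sending a function to
its continuous representative. -/
def toBCF : H1 →L[ℂ] BoundedContinuousFunction ℝ ℂ :=
  LinearMap.mkContinuous
    { toFun := fun f => f.exists_continuous.choose
      map_add' := fun f g => bcf_ext <| by
        filter_upwards [(f + g).exists_continuous.choose_spec.1,
          f.exists_continuous.choose_spec.1, g.exists_continuous.choose_spec.1,
          Lp.coeFn_add f.toL2 g.toL2] with x h1 h2 h3 h4
        rw [BoundedContinuousFunction.add_apply, ← h1, ← h2, ← h3, ← Pi.add_apply, ← h4]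
        rfl
      map_smul' := fun c f => bcf_ext <| by
        filter_upwards [(c • f).exists_continuous.choose_spec.1,
          f.exists_continuous.choose_spec.1, Lp.coeFn_smul c f.toL2] with x h1 h2 h3
        rw [RingHom.id_apply, BoundedContinuousFunction.smul_apply, ← h1, ← h2, ← Pi.smul_apply,
          ← h3]
        rfl } 2 fun f => by
    have := f.exists_continuous.choose_spec.2
    have h1 := f.norm_toL2_le
    have h2 := f.norm_dx_le
    simp only [LinearMap.coe_mk, AddHom.coe_mk]
    linarith

theorem toBCF_ae (f : H1) : ∀ᵐ x, f.toL2 x = toBCF f x :=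
  f.exists_continuous.choose_spec.1

theorem norm_toBCF_le (f : H1) : ‖toBCF f‖ ≤ 2 * ‖f‖ := by
  have h0 : ‖toBCF f‖ ≤ ‖f.toL2‖ + ‖f.dx‖ := f.exists_continuous.choose_spec.2
  have h1 := f.norm_toL2_le
  have h2 := f.norm_dx_le
  linarith

/-- Pairs with the same function component agree, since weak derivatives are unique. -/
theorem HasWeakDeriv.unique {f g g' : L2} (h : HasWeakDeriv f g) (h' : HasWeakDeriv f g') :
    g = g' := by
  have h1 := (h.hasDerivAt_shift 0).unique (h'.hasDerivAt_shift 0)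
  rwa [shift_zero, shift_zero] at h1

theorem toL2_injective : Function.Injective H1.toL2 := by
  intro f g h
  have h' : f.dx = g.dx := by
    have := f.hasWeakDeriv
    rw [h] at this
    exact this.unique g.hasWeakDeriv
  exact Subtype.ext (WithLp.ofLp_injective 2 (Prod.ext h h'))

/-- An element of `H¹(ℝ)` is determined by the values of its continuous representative. -/
theorem H1.ext_toBCF {f g : H1} (h : ∀ x, toBCF f x = toBCF g x) : f = g :=
  toL2_injective <| Lp.ext <| by
    filter_upwards [toBCF_ae f, toBCF_ae g] with x h1 h2
    rw [h1, h2, h]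

/-! ### Translation, conjugation and multiplication on `H¹(ℝ)` -/

/-- The element of `H¹(ℝ)` with given function and weak derivative. -/
def H1.mk (f g : L2) (h : HasWeakDeriv f g) : H1 := ⟨WithLp.toLp 2 (f, g), h⟩

theorem H1.norm_congr {f g : H1} (h : ‖f.toL2‖ = ‖g.toL2‖) (h' : ‖f.dx‖ = ‖g.dx‖) :
    ‖f‖ = ‖g‖ := by
  rw [← sq_eq_sq₀ (norm_nonneg _) (norm_nonneg _), f.norm_sq_eq, g.norm_sq_eq, h, h']

theorem H1.tendsto {α : Type*} {l : Filter α} {f : α → H1} {g : H1}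
    (h : Tendsto (fun a => (f a).toL2) l (𝓝 g.toL2)) (h' : Tendsto (fun a => (f a).dx) l (𝓝 g.dx)) :
    Tendsto f l (𝓝 g) := by
  rw [tendsto_iff_norm_sub_tendsto_zero] at *
  have := h.add h'
  rw [add_zero] at this
  exact squeeze_zero (fun _ => norm_nonneg _) (fun a => (f a - g).norm_le) this

/-- The translation `f ↦ f (· + s)` on `H¹(ℝ)`. -/
def shiftH (s : ℝ) : H1 →ₗᵢ[ℂ] H1 where
  toFun f := H1.mk (shift s f.toL2) (shift s f.dx) (f.hasWeakDeriv.shift s)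
  map_add' f g := toL2_injective (map_add (shift s) f.toL2 g.toL2)
  map_smul' c f := toL2_injective (map_smul (shift s) c f.toL2)
  norm_map' f := H1.norm_congr ((shift s).norm_map f.toL2) ((shift s).norm_map f.dx)

theorem toL2_shiftH (s : ℝ) (f : H1) : (shiftH s f).toL2 = shift s f.toL2 := rfl

theorem tendsto_shiftH {α : Type*} {l : Filter α} {s : α → ℝ} {f : α → H1} {s₀ : ℝ} {f₀ : H1}
    (hs : Tendsto s l (𝓝 s₀)) (hf : Tendsto f l (𝓝 f₀)) :
    Tendsto (fun a => shiftH (s a) (f a)) l (𝓝 (shiftH s₀ f₀)) :=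
  H1.tendsto (tendsto_shift hs ((toL2L.continuous.tendsto f₀).comp hf))
    (tendsto_shift hs ((dxL.continuous.tendsto f₀).comp hf))

theorem shiftH_shiftH (s t : ℝ) (f : H1) : shiftH s (shiftH t f) = shiftH (s + t) f :=
  toL2_injective (shift_shift s t f.toL2)

theorem shiftH_zero (f : H1) : shiftH 0 f = f := toL2_injective (shift_zero f.toL2)

theorem toBCF_shiftH (s : ℝ) (f : H1) (x : ℝ) : toBCF (shiftH s f) x = toBCF f (x + s) := by
  have h : ∀ᵐ x, toBCF (shiftH s f) x = toBCF f (x + s) := by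
    filter_upwards [toBCF_ae (shiftH s f), ae_comp_add (toBCF_ae f) s, shift_ae s f.toL2]
      with x h1 h2 h3
    rw [← h1, ← h2, ← h3]; rfl
  have hc : Continuous fun x => toBCF f (x + s) := by fun_prop
  exact congrFun (((toBCF (shiftH s f)).continuous.ae_eq_iff_eq volume hc).1 h) x

theorem norm_toBCF_shiftH (s : ℝ) (f : H1) : ‖toBCF (shiftH s f)‖ = ‖toBCF f‖ := by
  refine le_antisymm ?_ ?_ <;> rw [BoundedContinuousFunction.norm_le (norm_nonneg _)] <;> intro x
  · rw [toBCF_shiftH]; exact (toBCF f).norm_coe_le_norm _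
  · rw [← sub_add_cancel x s, ← toBCF_shiftH]; exact (toBCF _).norm_coe_le_norm _

/-- Complex conjugation on `L²(ℝ)`. -/
def conjL2 : L2 →L[ℝ] L2 := (Complex.conjCLE : ℂ →L[ℝ] ℂ).compLpL 2 volume

theorem conjL2_ae (f : L2) : ∀ᵐ x, conjL2 f x = star (f x) :=
  (Complex.conjCLE : ℂ →L[ℝ] ℂ).coeFn_compLpL f

theorem norm_conjL2 (f : L2) : ‖conjL2 f‖ = ‖f‖ := by
  refine le_antisymm (Lp.norm_le_norm_of_ae_le ?_) (Lp.norm_le_norm_of_ae_le ?_) <;>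
  filter_upwards [conjL2_ae f] with x hx <;> rw [hx, norm_star]

theorem HasWeakDeriv.conj {f g : L2} (h : HasWeakDeriv f g) :
    HasWeakDeriv (conjL2 f) (conjL2 g) := by
  apply hasWeakDeriv_of_hasDerivAt_shift
  have hd := h.hasDerivAt_shift 0
  rw [shift_zero] at hd
  refine (conjL2.hasFDerivAt.comp_hasDerivAt 0 hd).congr_of_eventuallyEq (.of_forall fun s => ?_)
  apply Lp.ext
  filter_upwards [shift_ae s (conjL2 f), ae_comp_add (conjL2_ae f) s,
    conjL2_ae (DiracH1.shift s f), shift_ae s f] with x h1 h2 h3 h4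
  rw [h1, h2, Function.comp_apply, h3, h4]

/-- Complex conjugation on `H¹(ℝ)`. -/
def conjH : H1 →ₗᵢ[ℝ] H1 where
  toFun f := H1.mk (conjL2 f.toL2) (conjL2 f.dx) f.hasWeakDeriv.conj
  map_add' f g := toL2_injective (map_add conjL2 f.toL2 g.toL2)
  map_smul' c f := toL2_injective (map_smul conjL2 c f.toL2)
  norm_map' f := H1.norm_congr (norm_conjL2 f.toL2) (norm_conjL2 f.dx)

theorem toBCF_conjH (f : H1) (x : ℝ) : toBCF (conjH f) x = star (toBCF f x) := by
  have h : toBCF (conjH f) = star (toBCF f) := bcf_ext <| by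
    filter_upwards [toBCF_ae (conjH f), toBCF_ae f, conjL2_ae f.toL2] with x h1 h2 h3
    rw [BoundedContinuousFunction.star_apply, ← h1, ← h2, ← h3]; rfl
  rw [h]; rfl

theorem norm_toBCF_conjH (f : H1) : ‖toBCF (conjH f)‖ = ‖toBCF f‖ := by
  refine le_antisymm ?_ ?_ <;> rw [BoundedContinuousFunction.norm_le (norm_nonneg _)] <;> intro x
  · rw [toBCF_conjH, norm_star]; exact (toBCF f).norm_coe_le_norm _
  · rw [← norm_star, ← toBCF_conjH]; exact (toBCF _).norm_coe_le_norm _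

theorem memLp_mul (F : BoundedContinuousFunction ℝ ℂ) (g : L2) :
    MemLp (fun x => F x * g x) 2 volume :=
  (Lp.memLp g).of_le_mul
    (F.continuous.aestronglyMeasurable.mul (Lp.aestronglyMeasurable g)) (c := ‖F‖)
    (.of_forall fun x => by
      rw [norm_mul]
      exact mul_le_mul_of_nonneg_right (F.norm_coe_le_norm x) (norm_nonneg _))

/-- Multiplication of a function in `L²(ℝ)` by a bounded continuous function. -/
def mulBL : BoundedContinuousFunction ℝ ℂ →L[ℂ] L2 →L[ℂ] L2 :=
  LinearMap.mkContinuous₂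
    (LinearMap.mk₂ ℂ (fun F g => (memLp_mul F g).toLp)
      (fun F G g => Lp.ext <| by
        filter_upwards [(memLp_mul (F + G) g).coeFn_toLp, (memLp_mul F g).coeFn_toLp,
          (memLp_mul G g).coeFn_toLp,
          Lp.coeFn_add (memLp_mul F g).toLp (memLp_mul G g).toLp] with x h1 h2 h3 h4
        rw [h1, h4, Pi.add_apply, h2, h3, BoundedContinuousFunction.add_apply, add_mul])
      (fun c F g => Lp.ext <| by
        filter_upwards [(memLp_mul (c • F) g).coeFn_toLp, (memLp_mul F g).coeFn_toLp,
          Lp.coeFn_smul c (memLp_mul F g).toLp] with x h1 h2 h4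
        rw [h1, h4, Pi.smul_apply, h2, BoundedContinuousFunction.smul_apply, smul_mul_assoc])
      (fun F g h => Lp.ext <| by
        filter_upwards [(memLp_mul F (g + h)).coeFn_toLp, (memLp_mul F g).coeFn_toLp,
          (memLp_mul F h).coeFn_toLp, Lp.coeFn_add g h,
          Lp.coeFn_add (memLp_mul F g).toLp (memLp_mul F h).toLp] with x h1 h2 h3 h5 h4
        rw [h1, h4, Pi.add_apply, h2, h3, h5, Pi.add_apply, mul_add])
      (fun c F g => Lp.ext <| by
        filter_upwards [(memLp_mul F (c • g)).coeFn_toLp, (memLp_mul F g).coeFn_toLp,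
          Lp.coeFn_smul c g, Lp.coeFn_smul c (memLp_mul F g).toLp] with x h1 h2 h5 h4
        rw [h1, h4, Pi.smul_apply, h2, h5, Pi.smul_apply, mul_smul_comm])) 1
    (fun F g => by
      rw [one_mul]
      refine Lp.norm_le_mul_norm_of_ae_le_mul ?_
      filter_upwards [(memLp_mul F g).coeFn_toLp] with x h1
      rw [LinearMap.mk₂_apply, h1, norm_mul]
      exact mul_le_mul_of_nonneg_right (F.norm_coe_le_norm x) (norm_nonneg _))

theorem mulBL_ae (F : BoundedContinuousFunction ℝ ℂ) (g : L2) :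
    ∀ᵐ x, mulBL F g x = F x * g x := (memLp_mul F g).coeFn_toLp

theorem norm_mulBL_le (F : BoundedContinuousFunction ℝ ℂ) (g : L2) :
    ‖mulBL F g‖ ≤ ‖F‖ * ‖g‖ := by
  refine Lp.norm_le_mul_norm_of_ae_le_mul ?_
  filter_upwards [mulBL_ae F g] with x h1
  rw [h1, norm_mul]
  exact mul_le_mul_of_nonneg_right (F.norm_coe_le_norm x) (norm_nonneg _)

/-- The Leibniz rule in `H¹(ℝ)`, proved for the difference quotients
`(f (x + h) g (x + h) - f x g x) / h` in `L²(ℝ)`. -/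
theorem hasWeakDeriv_mul (f g : H1) :
    HasWeakDeriv (mulBL (toBCF f) g.toL2)
      (mulBL (toBCF f) g.dx + mulBL (toBCF g) f.dx) := by
  apply hasWeakDeriv_of_hasDerivAt_shift
  have hf := f.hasWeakDeriv.hasDerivAt_shift 0
  have hg := g.hasWeakDeriv.hasDerivAt_shift 0
  rw [shift_zero, hasDerivAt_iff_tendsto_slope_zero] at hf hg
  rw [hasDerivAt_iff_tendsto_slope_zero]
  have h1 : Tendsto (fun h : ℝ => toBCF (shiftH h f)) (𝓝[≠] 0) (𝓝 (toBCF f)) := by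
    have : Tendsto (fun h : ℝ => shiftH h f) (𝓝[≠] 0) (𝓝 (shiftH 0 f)) :=
      tendsto_shiftH (tendsto_id.mono_left nhdsWithin_le_nhds) tendsto_const_nhds
    rw [shiftH_zero] at this
    exact (toBCF.continuous.tendsto f).comp this
  have h2 := (mulBL.isBoundedBilinearMap.continuous.tendsto (toBCF f, g.dx)).comp
    (h1.prodMk_nhds hg)
  have h3 := ((mulBL (toBCF g)).continuous.tendsto f.dx).comp hf
  refine (h2.add h3).congr fun h => ?_
  simp only [Function.comp_apply, zero_add, shift_zero]
  apply Lp.ext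
  have s1 := Lp.coeFn_add (mulBL (toBCF (shiftH h f)) (h⁻¹ • (shift h g.toL2 - g.toL2)))
    (mulBL (toBCF g) (h⁻¹ • (shift h f.toL2 - f.toL2)))
  have s2 := Lp.coeFn_smul h⁻¹ (shift h (mulBL (toBCF f) g.toL2) - mulBL (toBCF f) g.toL2)
  have s3 := Lp.coeFn_smul h⁻¹ (shift h g.toL2 - g.toL2)
  have s4 := Lp.coeFn_smul h⁻¹ (shift h f.toL2 - f.toL2)
  filter_upwards [s1, s2, s3, s4, Lp.coeFn_sub (shift h g.toL2) g.toL2,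
    Lp.coeFn_sub (shift h f.toL2) f.toL2,
    Lp.coeFn_sub (shift h (mulBL (toBCF f) g.toL2)) (mulBL (toBCF f) g.toL2),
    mulBL_ae (toBCF (shiftH h f)) (h⁻¹ • (shift h g.toL2 - g.toL2)),
    mulBL_ae (toBCF g) (h⁻¹ • (shift h f.toL2 - f.toL2)), mulBL_ae (toBCF f) g.toL2,
    ae_comp_add (mulBL_ae (toBCF f) g.toL2) h, shift_ae h (mulBL (toBCF f) g.toL2),
    shift_ae h g.toL2, shift_ae h f.toL2, toBCF_ae f, toBCF_ae g, ae_comp_add (toBCF_ae f) h]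
    with x e1 e2 e3 e4 e5 e6 e7 e8 e9 e10 e11 e12 e13 e14 e15 e16 e17
  rw [e1, e2, Pi.add_apply, Pi.smul_apply, e7, e8, e9, e3, e4, Pi.smul_apply, Pi.smul_apply, e5,
    e6, Pi.sub_apply, Pi.sub_apply, Pi.sub_apply, e12, e11, e10, e13, e14, toBCF_shiftH, e15, e16,
    e17]
  simp only [Complex.real_smul]
  ring

/-- The pointwise product on `H¹(ℝ)`. -/
def mulH (f g : H1) : H1 := H1.mk _ _ (hasWeakDeriv_mul f g)

theorem toBCF_mulH (f g : H1) (x : ℝ) : toBCF (mulH f g) x = toBCF f x * toBCF g x := by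
  have h : toBCF (mulH f g) = toBCF f * toBCF g := bcf_ext <| by
    filter_upwards [toBCF_ae (mulH f g), toBCF_ae g, mulBL_ae (toBCF f) g.toL2] with x h1 h2 h3
    rw [BoundedContinuousFunction.mul_apply, ← h1, ← h2, ← h3]; rfl
  rw [h]; rfl

theorem norm_toBCF_mulH_le (f g : H1) : ‖toBCF (mulH f g)‖ ≤ ‖toBCF f‖ * ‖toBCF g‖ := by
  rw [BoundedContinuousFunction.norm_le (by positivity)]
  intro x
  rw [toBCF_mulH, norm_mul]
  exact mul_le_mul ((toBCF f).norm_coe_le_norm x) ((toBCF g).norm_coe_le_norm x) (norm_nonneg _)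
    (norm_nonneg _)

/-- The tame product estimate: each factor enters once with its `H¹` norm and once with its
supremum. -/
theorem norm_mulH_le (f g : H1) :
    ‖mulH f g‖ ≤ 2 * (‖toBCF f‖ * ‖g‖ + ‖toBCF g‖ * ‖f‖) := by
  have h1 : ‖(mulH f g).toL2‖ ≤ ‖toBCF f‖ * ‖g‖ :=
    (norm_mulBL_le (toBCF f) g.toL2).trans (by gcongr; exact g.norm_toL2_le)
  have h2 : ‖(mulH f g).dx‖ ≤ ‖toBCF f‖ * ‖g‖ + ‖toBCF g‖ * ‖f‖ := by
    refine (norm_add_le (mulBL (toBCF f) g.dx) (mulBL (toBCF g) f.dx)).trans ?_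
    refine add_le_add ((norm_mulBL_le _ _).trans ?_) ((norm_mulBL_le _ _).trans ?_)
    · gcongr; exact g.norm_dx_le
    · gcongr; exact f.norm_dx_le
  have h3 := (mulH f g).norm_le
  have h4 : 0 ≤ ‖toBCF g‖ * ‖f‖ := by positivity
  linarith

theorem norm_mulH_le' (f g : H1) : ‖mulH f g‖ ≤ 8 * ‖f‖ * ‖g‖ := by
  have h1 : ‖toBCF f‖ * ‖g‖ ≤ 2 * ‖f‖ * ‖g‖ := by gcongr; exact norm_toBCF_le f
  have h2 : ‖toBCF g‖ * ‖f‖ ≤ 2 * ‖g‖ * ‖f‖ := by gcongr; exact norm_toBCF_le g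
  nlinarith [norm_mulH_le f g]

theorem mulH_sub_mulH (f g f' g' : H1) :
    mulH f g - mulH f' g' = mulH (f - f') g + mulH f' (g - g') := by
  apply H1.ext_toBCF
  intro x
  simp only [map_sub, map_add, BoundedContinuousFunction.sub_apply,
    BoundedContinuousFunction.add_apply, toBCF_mulH]
  ring

/-! ### Tame maps on `H¹(ℝ) × H¹(ℝ)` -/

/-- The pair of continuous representatives; its norm is the supremum norm of the pair. -/
def bcfPair : H1 × H1 →L[ℂ] BoundedContinuousFunction ℝ ℂ × BoundedContinuousFunction ℝ ℂ :=
  toBCF.prodMap toBCF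

theorem norm_bcfPair (w : H1 × H1) : ‖bcfPair w‖ = max ‖toBCF w.1‖ ‖toBCF w.2‖ := rfl

theorem norm_bcfPair_le (w : H1 × H1) : ‖bcfPair w‖ ≤ 2 * ‖w‖ := by
  rw [norm_bcfPair, Prod.norm_def, mul_max_of_nonneg _ _ (by norm_num : (0 : ℝ) ≤ 2)]
  exact max_le_max (norm_toBCF_le _) (norm_toBCF_le _)

/-- A tame map on `H¹(ℝ) × H¹(ℝ)`: it is Lipschitz on bounded sets, and its norm is bounded by a
multiple of the `H¹` norm of the argument, where the factor depends on the supremum norm of the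
argument only. -/
structure IsTame {F : Type*} [NormedAddCommGroup F] (N : H1 × H1 → F) : Prop where
  lipschitz : ∀ R : ℝ, ∃ K : ℝ, 0 ≤ K ∧
    ∀ w w', ‖w‖ ≤ R → ‖w'‖ ≤ R → ‖N w - N w'‖ ≤ K * ‖w - w'‖
  linear_bound : ∀ M : ℝ, ∃ C : ℝ, 0 ≤ C ∧ ∀ w, ‖bcfPair w‖ ≤ M → ‖N w‖ ≤ C * ‖w‖

/-- The supremum norm of `N w` is controlled by the supremum norm of `w`. -/
def SupBounded (N : H1 × H1 → H1) : Prop :=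
  ∀ M : ℝ, ∃ C : ℝ, 0 ≤ C ∧ ∀ w, ‖bcfPair w‖ ≤ M → ‖toBCF (N w)‖ ≤ C

theorem IsTame.bounded {F : Type*} [NormedAddCommGroup F] {N : H1 × H1 → F} (hN : IsTame N)
    (R : ℝ) : ∃ B : ℝ, 0 ≤ B ∧ ∀ w, ‖w‖ ≤ R → ‖N w‖ ≤ B := by
  obtain ⟨C, hC, h⟩ := hN.linear_bound (2 * R)
  refine ⟨C * |R|, by positivity, fun w hw => (h w ?_).trans ?_⟩
  · exact (norm_bcfPair_le w).trans (by gcongr)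
  · gcongr; exact hw.trans (le_abs_self R)

theorem isTame_fst : IsTame (fun w : H1 × H1 => w.1) :=
  ⟨fun _ => ⟨1, zero_le_one, fun w w' _ _ => by rw [one_mul]; exact norm_fst_le (w - w')⟩,
    fun _ => ⟨1, zero_le_one, fun w _ => by rw [one_mul]; exact norm_fst_le w⟩⟩

theorem isTame_snd : IsTame (fun w : H1 × H1 => w.2) :=
  ⟨fun _ => ⟨1, zero_le_one, fun w w' _ _ => by rw [one_mul]; exact norm_snd_le (w - w')⟩,
    fun _ => ⟨1, zero_le_one, fun w _ => by rw [one_mul]; exact norm_snd_le w⟩⟩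

theorem supBounded_fst : SupBounded (fun w : H1 × H1 => w.1) := fun M =>
  ⟨|M|, abs_nonneg _, fun _ hw => (le_max_left _ _).trans (hw.trans (le_abs_self M))⟩

theorem supBounded_snd : SupBounded (fun w : H1 × H1 => w.2) := fun M =>
  ⟨|M|, abs_nonneg _, fun _ hw => (le_max_right _ _).trans (hw.trans (le_abs_self M))⟩

theorem IsTame.add {N N' : H1 × H1 → H1} (h : IsTame N) (h' : IsTame N') :
    IsTame (fun w => N w + N' w) where
  lipschitz R := by
    obtain ⟨K, hK, hl⟩ := h.lipschitz R
    obtain ⟨K', hK', hl'⟩ := h'.lipschitz R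
    refine ⟨K + K', by positivity, fun w w' hw hw' => ?_⟩
    rw [add_sub_add_comm, add_mul]
    exact norm_add_le_of_le (hl w w' hw hw') (hl' w w' hw hw')
  linear_bound M := by
    obtain ⟨C, hC, hb⟩ := h.linear_bound M
    obtain ⟨C', hC', hb'⟩ := h'.linear_bound M
    refine ⟨C + C', by positivity, fun w hw => ?_⟩
    rw [add_mul]
    exact norm_add_le_of_le (hb w hw) (hb' w hw)

theorem SupBounded.add {N N' : H1 × H1 → H1} (h : SupBounded N) (h' : SupBounded N') :
    SupBounded (fun w => N w + N' w) := fun M => by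
  obtain ⟨C, hC, hb⟩ := h M
  obtain ⟨C', hC', hb'⟩ := h' M
  refine ⟨C + C', by positivity, fun w hw => ?_⟩
  rw [map_add]
  exact norm_add_le_of_le (hb w hw) (hb' w hw)

theorem IsTame.smul {N : H1 × H1 → H1} (h : IsTame N) (c : ℂ) : IsTame (fun w => c • N w) where
  lipschitz R := by
    obtain ⟨K, hK, hl⟩ := h.lipschitz R
    refine ⟨‖c‖ * K, by positivity, fun w w' hw hw' => ?_⟩
    rw [← smul_sub, norm_smul, mul_assoc]
    exact mul_le_mul_of_nonneg_left (hl w w' hw hw') (norm_nonneg c)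
  linear_bound M := by
    obtain ⟨C, hC, hb⟩ := h.linear_bound M
    refine ⟨‖c‖ * C, by positivity, fun w hw => ?_⟩
    rw [norm_smul, mul_assoc]
    exact mul_le_mul_of_nonneg_left (hb w hw) (norm_nonneg c)

theorem SupBounded.smul {N : H1 × H1 → H1} (h : SupBounded N) (c : ℂ) :
    SupBounded (fun w => c • N w) := fun M => by
  obtain ⟨C, hC, hb⟩ := h M
  refine ⟨‖c‖ * C, by positivity, fun w hw => ?_⟩
  rw [map_smul, norm_smul]
  exact mul_le_mul_of_nonneg_left (hb w hw) (norm_nonneg c)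

theorem IsTame.conj {N : H1 × H1 → H1} (h : IsTame N) : IsTame (fun w => conjH (N w)) where
  lipschitz R := by
    obtain ⟨K, hK, hl⟩ := h.lipschitz R
    refine ⟨K, hK, fun w w' hw hw' => ?_⟩
    rw [← map_sub, conjH.norm_map]
    exact hl w w' hw hw'
  linear_bound M := by
    obtain ⟨C, hC, hb⟩ := h.linear_bound M
    exact ⟨C, hC, fun w hw => by rw [conjH.norm_map]; exact hb w hw⟩

theorem SupBounded.conj {N : H1 × H1 → H1} (h : SupBounded N) :
    SupBounded (fun w => conjH (N w)) := fun M => by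
  obtain ⟨C, hC, hb⟩ := h M
  exact ⟨C, hC, fun w hw => by rw [norm_toBCF_conjH]; exact hb w hw⟩

theorem IsTame.mul {N N' : H1 × H1 → H1} (h : IsTame N) (h' : IsTame N') (hs : SupBounded N)
    (hs' : SupBounded N') : IsTame (fun w => mulH (N w) (N' w)) where
  lipschitz R := by
    obtain ⟨K, hK, hl⟩ := h.lipschitz R
    obtain ⟨K', hK', hl'⟩ := h'.lipschitz R
    obtain ⟨B, hB, hb⟩ := h.bounded R
    obtain ⟨B', hB', hb'⟩ := h'.bounded R
    refine ⟨8 * K * B' + 8 * B * K', by positivity, fun w w' hw hw' => ?_⟩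
    rw [mulH_sub_mulH]
    calc ‖mulH (N w - N w') (N' w) + mulH (N w') (N' w - N' w')‖
        ≤ 8 * ‖N w - N w'‖ * ‖N' w‖ + 8 * ‖N w'‖ * ‖N' w - N' w'‖ :=
          norm_add_le_of_le (norm_mulH_le' _ _) (norm_mulH_le' _ _)
      _ ≤ 8 * (K * ‖w - w'‖) * B' + 8 * B * (K' * ‖w - w'‖) := by
          gcongr
          exacts [hl w w' hw hw', hb' w hw, hb w' hw', hl' w w' hw hw']
      _ = _ := by ring
  linear_bound M := by
    obtain ⟨C, hC, hb⟩ := h.linear_bound M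
    obtain ⟨C', hC', hb'⟩ := h'.linear_bound M
    obtain ⟨D, hD, hd⟩ := hs M
    obtain ⟨D', hD', hd'⟩ := hs' M
    refine ⟨2 * (D * C' + D' * C), by positivity, fun w hw => ?_⟩
    calc ‖mulH (N w) (N' w)‖
        ≤ 2 * (‖toBCF (N w)‖ * ‖N' w‖ + ‖toBCF (N' w)‖ * ‖N w‖) := norm_mulH_le _ _
      _ ≤ 2 * (D * (C' * ‖w‖) + D' * (C * ‖w‖)) := by
          gcongr
          exacts [hd w hw, hb' w hw, hd' w hw, hb w hw]
      _ = _ := by ring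

theorem SupBounded.mul {N N' : H1 × H1 → H1} (h : SupBounded N) (h' : SupBounded N') :
    SupBounded (fun w => mulH (N w) (N' w)) := fun M => by
  obtain ⟨C, hC, hb⟩ := h M
  obtain ⟨C', hC', hb'⟩ := h' M
  exact ⟨C * C', by positivity, fun w hw => (norm_toBCF_mulH_le _ _).trans
    (mul_le_mul (hb w hw) (hb' w hw) (norm_nonneg _) hC)⟩

theorem IsTame.prodMk {F G : Type*} [NormedAddCommGroup F] [NormedAddCommGroup G]
    {N : H1 × H1 → F} {N' : H1 × H1 → G} (h : IsTame N)
    (h' : IsTame N') : IsTame (fun w => (N w, N' w)) where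
  lipschitz R := by
    obtain ⟨K, hK, hl⟩ := h.lipschitz R
    obtain ⟨K', hK', hl'⟩ := h'.lipschitz R
    refine ⟨max K K', le_max_of_le_left hK, fun w w' hw hw' => max_le ?_ ?_⟩
    · exact (hl w w' hw hw').trans (by gcongr; exact le_max_left _ _)
    · exact (hl' w w' hw hw').trans (by gcongr; exact le_max_right _ _)
  linear_bound M := by
    obtain ⟨C, hC, hb⟩ := h.linear_bound M
    obtain ⟨C', hC', hb'⟩ := h'.linear_bound M
    refine ⟨max C C', le_max_of_le_left hC, fun w hw => max_le ?_ ?_⟩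
    · exact (hb w hw).trans (by gcongr; exact le_max_left _ _)
    · exact (hb' w hw).trans (by gcongr; exact le_max_right _ _)

theorem IsTame.continuous {F : Type*} [NormedAddCommGroup F] {N : H1 × H1 → F} (h : IsTame N) :
    Continuous N := by
  rw [continuous_iff_continuousAt]
  intro w
  obtain ⟨K, hK, hl⟩ := h.lipschitz (‖w‖ + 1)
  have : LipschitzOnWith ⟨K, hK⟩ N (Metric.closedBall 0 (‖w‖ + 1)) :=
    LipschitzOnWith.of_dist_le_mul fun x hx y hy => by
      rw [mem_closedBall_zero_iff] at hx hy
      rw [dist_eq_norm, dist_eq_norm]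
      exact hl x y hx hy
  refine this.continuousOn.continuousAt (mem_of_superset (Metric.ball_mem_nhds w one_pos) ?_)
  intro x hx
  rw [mem_closedBall_zero_iff]
  rw [mem_ball_iff_norm] at hx
  linarith [norm_le_norm_add_norm_sub w x, norm_sub_rev w x]

/-- The arguments `(|u x|², |v x|²)` at which the polynomials are evaluated. -/
def moduli (w : H1 × H1) (x : ℝ) : Fin 2 → ℝ := ![‖toBCF w.1 x‖ ^ 2, ‖toBCF w.2 x‖ ^ 2]

/-- Multiplication by a polynomial in `|u|²` and `|v|²` preserves tame maps. -/
theorem exists_poly_mul (P : MvPolynomial (Fin 2) ℝ) (N : H1 × H1 → H1) (hN : IsTame N)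
    (hs : SupBounded N) : ∃ N' : H1 × H1 → H1, IsTame N' ∧ SupBounded N' ∧
      ∀ w x, toBCF (N' w) x = (MvPolynomial.eval (moduli w x) P : ℂ) * toBCF (N w) x := by
  induction P using MvPolynomial.induction_on with
  | C a =>
    refine ⟨fun w => (a : ℂ) • N w, hN.smul _, hs.smul _, fun w x => ?_⟩
    rw [map_smul, BoundedContinuousFunction.smul_apply, MvPolynomial.eval_C, smul_eq_mul]
  | add p q hp hq =>
    obtain ⟨A, hA, hAs, hAe⟩ := hp
    obtain ⟨B, hB, hBs, hBe⟩ := hq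
    refine ⟨fun w => A w + B w, hA.add hB, hAs.add hBs, fun w x => ?_⟩
    rw [map_add, BoundedContinuousFunction.add_apply, hAe, hBe, map_add, Complex.ofReal_add,
      add_mul]
  | mul_X p i hp =>
    obtain ⟨A, hA, hAs, hAe⟩ := hp
    obtain ⟨B, hB, hBs, hBe⟩ : ∃ B : H1 × H1 → H1, IsTame B ∧ SupBounded B ∧
        ∀ w x, toBCF (B w) x * star (toBCF (B w) x) = (moduli w x i : ℂ) := by
      have key (z : ℂ) : z * star z = ((‖z‖ ^ 2 : ℝ) : ℂ) := by
        rw [Complex.star_def, Complex.mul_conj, Complex.normSq_eq_norm_sq]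
      fin_cases i
      · exact ⟨_, isTame_fst, supBounded_fst, fun w x => key _⟩
      · exact ⟨_, isTame_snd, supBounded_snd, fun w x => key _⟩
    refine ⟨fun w => mulH (mulH (B w) (conjH (B w))) (A w),
      (hB.mul hB.conj hBs hBs.conj).mul hA (hBs.mul hBs.conj) hAs,
      (hBs.mul hBs.conj).mul hAs, fun w x => ?_⟩
    rw [toBCF_mulH, toBCF_mulH, toBCF_conjH, hBe, hAe, map_mul, MvPolynomial.eval_X]
    push_cast
    ring

/-! ### Wirtinger derivatives and the Dirac field -/

theorem hasDerivAt_eval_update (P : MvPolynomial (Fin 2) ℝ) (y : Fin 2 → ℝ) (i : Fin 2) (t : ℝ) :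
    HasDerivAt (fun t => MvPolynomial.eval (Function.update y i t) P)
      (MvPolynomial.eval (Function.update y i t) (MvPolynomial.pderiv i P)) t := by
  induction P using MvPolynomial.induction_on with
  | C a => simpa using hasDerivAt_const t a
  | add p q hp hq =>
    simp only [map_add]
    exact hp.add hq
  | mul_X p j hp =>
    have hX : HasDerivAt (fun t => Function.update y i t j) (if j = i then 1 else 0) t := by
      split_ifs with h
      · subst h; simpa using hasDerivAt_id' t
      · simpa [h] using hasDerivAt_const t (y j)
    have := hp.mul hX
    simp only [map_mul, MvPolynomial.eval_X, Derivation.leibniz, map_add, smul_eq_mul]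
    refine this.congr_deriv ?_
    rw [MvPolynomial.pderiv_X]
    by_cases h : j = i
    · subst h; simp; ring
    · simp [h]; ring

/-- The Wirtinger derivative of a function of the modulus squared: `∂_{z̄} p(|z|²) = p'(|z|²) z`. -/
theorem wirtingerBar_comp_norm_sq {p : ℝ → ℝ} {p' : ℝ} {z : ℂ}
    (hp : HasDerivAt p p' (‖z‖ ^ 2)) : wirtingerBar (fun z => p (‖z‖ ^ 2)) z = p' * z := by
  have h := hp.comp_hasFDerivAt z (hasStrictFDerivAt_norm_sq z).hasFDerivAt
  rw [wirtingerBar, show (fun z : ℂ => p (‖z‖ ^ 2)) = p ∘ fun z : ℂ => ‖z‖ ^ 2 from rfl, h.fderiv]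
  apply Complex.ext <;> simp [Complex.inner] <;> ring

theorem wirtingerBar_fst (P : MvPolynomial (Fin 2) ℝ) (u v : ℂ) :
    wirtingerBar (fun z => MvPolynomial.eval ![‖z‖ ^ 2, ‖v‖ ^ 2] P) u =
      MvPolynomial.eval ![‖u‖ ^ 2, ‖v‖ ^ 2] (MvPolynomial.pderiv 0 P) * u := by
  have key (t : ℝ) : Function.update ![0, ‖v‖ ^ 2] 0 t = ![t, ‖v‖ ^ 2] := by
    ext j; fin_cases j <;> simp
  have h := hasDerivAt_eval_update P ![0, ‖v‖ ^ 2] 0 (‖u‖ ^ 2)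
  simp_rw [key] at h
  exact wirtingerBar_comp_norm_sq h

theorem wirtingerBar_snd (P : MvPolynomial (Fin 2) ℝ) (u v : ℂ) :
    wirtingerBar (fun z => MvPolynomial.eval ![‖u‖ ^ 2, ‖z‖ ^ 2] P) v =
      MvPolynomial.eval ![‖u‖ ^ 2, ‖v‖ ^ 2] (MvPolynomial.pderiv 1 P) * v := by
  have key (t : ℝ) : Function.update ![‖u‖ ^ 2, 0] 1 t = ![‖u‖ ^ 2, t] := by
    ext j; fin_cases j <;> simp
  have h := hasDerivAt_eval_update P ![‖u‖ ^ 2, 0] 1 (‖v‖ ^ 2)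
  simp_rw [key] at h
  exact wirtingerBar_comp_norm_sq h

/-- A tame vector field `N` on `H¹(ℝ) × H¹(ℝ)` whose components are, pointwise, `i v - i ∂W/∂ū` and
`i u - i ∂W/∂v̄`. -/
structure IsDiracField (W : ℂ → ℂ → ℝ) (N : H1 × H1 → H1 × H1) : Prop where
  tame : IsTame N
  fst : ∀ w x, toBCF (N w).1 x = Complex.I * toBCF w.2 x -
    Complex.I * wirtingerBar (fun z => W z (toBCF w.2 x)) (toBCF w.1 x)
  snd : ∀ w x, toBCF (N w).2 x = Complex.I * toBCF w.1 x -
    Complex.I * wirtingerBar (fun z => W (toBCF w.1 x) z) (toBCF w.2 x)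
  /-- The forces `∂W/∂ū` and `∂W/∂v̄` are real multiples of `u` and `v`, so they do not contribute
  to the growth of `|u|²` and `|v|²`. -/
  gauge_fst : ∀ w x, |(star (toBCF w.1 x) * toBCF (N w).1 x).re| ≤ ‖toBCF w.1 x‖ * ‖toBCF w.2 x‖
  gauge_snd : ∀ w x, |(star (toBCF w.2 x) * toBCF (N w).2 x).re| ≤ ‖toBCF w.1 x‖ * ‖toBCF w.2 x‖

theorem abs_re_gauge_le (a : ℝ) (u v : ℂ) :
    |(star u * (Complex.I * v - Complex.I * (a * u))).re| ≤ ‖u‖ * ‖v‖ := by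
  have e : (star u * (Complex.I * v - Complex.I * (a * u))).re =
      (star u * (Complex.I * v)).re := by
    simp; ring
  rw [e]
  refine (Complex.abs_re_le_norm _).trans ?_
  simp

theorem exists_isDiracField {W : ℂ → ℂ → ℝ} (hW : IsPolynomialInModuli W) :
    ∃ N, IsDiracField W N := by
  obtain ⟨P, hP⟩ := hW
  obtain ⟨A, hA, -, hAe⟩ := exists_poly_mul (MvPolynomial.pderiv 0 P) _ isTame_fst supBounded_fst
  obtain ⟨B, hB, -, hBe⟩ := exists_poly_mul (MvPolynomial.pderiv 1 P) _ isTame_snd supBounded_snd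
  have e1 (w : H1 × H1) (x : ℝ) : toBCF (Complex.I • w.2 + (-Complex.I) • A w) x =
      Complex.I * toBCF w.2 x - Complex.I *
        (MvPolynomial.eval (moduli w x) (MvPolynomial.pderiv 0 P) * toBCF w.1 x) := by
    simp [hAe, sub_eq_add_neg]
  have e2 (w : H1 × H1) (x : ℝ) : toBCF (Complex.I • w.1 + (-Complex.I) • B w) x =
      Complex.I * toBCF w.1 x - Complex.I *
        (MvPolynomial.eval (moduli w x) (MvPolynomial.pderiv 1 P) * toBCF w.2 x) := by
    simp [hBe, sub_eq_add_neg]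
  refine ⟨fun w => (Complex.I • w.2 + (-Complex.I) • A w, Complex.I • w.1 + (-Complex.I) • B w),
    ?_, fun w x => ?_, fun w x => ?_, fun w x => ?_, fun w x => ?_⟩
  · exact ((isTame_snd.smul _).add (hA.smul _)).prodMk ((isTame_fst.smul _).add (hB.smul _))
  · simp_rw [hP]
    rw [wirtingerBar_fst, e1, moduli]
  · simp_rw [hP]
    rw [wirtingerBar_snd, e2, moduli]
  · rw [e1]
    exact abs_re_gauge_le _ _ _
  · rw [e2, mul_comm ‖_‖]
    exact abs_re_gauge_le _ _ _

/-! ### The free evolution and the equation in the interaction picture -/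

/-- The free transport group `(u, v) ↦ (u (· - t), v (· + t))` of the linear equations
`u_t + u_x = 0`, `v_t - v_x = 0`. -/
def evol (t : ℝ) : H1 × H1 →ₗᵢ[ℂ] H1 × H1 where
  toLinearMap := (shiftH (-t)).toLinearMap.prodMap (shiftH t).toLinearMap
  norm_map' w := by
    change max ‖shiftH (-t) w.1‖ ‖shiftH t w.2‖ = max ‖w.1‖ ‖w.2‖
    rw [LinearIsometry.norm_map, LinearIsometry.norm_map]

theorem evol_apply (t : ℝ) (w : H1 × H1) : evol t w = (shiftH (-t) w.1, shiftH t w.2) := rfl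

theorem evol_evol (s t : ℝ) (w : H1 × H1) : evol s (evol t w) = evol (s + t) w := by
  simp only [evol_apply, shiftH_shiftH, neg_add]

theorem evol_zero (w : H1 × H1) : evol 0 w = w := by
  simp only [evol_apply, neg_zero, shiftH_zero]

theorem evol_evol_neg (t : ℝ) (w : H1 × H1) : evol t (evol (-t) w) = w := by
  rw [evol_evol, add_neg_cancel, evol_zero]

theorem tendsto_evol {α : Type*} {l : Filter α} {s : α → ℝ} {w : α → H1 × H1} {s₀ : ℝ}
    {w₀ : H1 × H1} (hs : Tendsto s l (𝓝 s₀)) (hw : Tendsto w l (𝓝 w₀)) :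
    Tendsto (fun a => evol (s a) (w a)) l (𝓝 (evol s₀ w₀)) :=
  (tendsto_shiftH hs.neg ((continuous_fst.tendsto w₀).comp hw)).prodMk_nhds
    (tendsto_shiftH hs ((continuous_snd.tendsto w₀).comp hw))

theorem norm_bcfPair_evol (t : ℝ) (w : H1 × H1) : ‖bcfPair (evol t w)‖ = ‖bcfPair w‖ := by
  simp only [norm_bcfPair, evol_apply, norm_toBCF_shiftH]

/-- The time-dependent vector field `z ↦ e^{-tA} N (e^{tA} z)` whose integral curves are the
solutions `w = e^{tA} z` of `w_t = A w + N w`, with `e^{tA}` the free transport group. -/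
def interaction (N : H1 × H1 → H1 × H1) (t : ℝ) (z : H1 × H1) : H1 × H1 :=
  evol (-t) (N (evol t z))

theorem continuous_interaction {N : H1 × H1 → H1 × H1} (hN : Continuous N) (z : H1 × H1) :
    Continuous fun t => interaction N t z := by
  rw [continuous_iff_continuousAt]
  intro t
  have h1 : Tendsto (fun t : ℝ => evol t z) (𝓝 t) (𝓝 (evol t z)) :=
    tendsto_evol tendsto_id tendsto_const_nhds
  exact tendsto_evol (continuous_neg.tendsto t) ((hN.tendsto (evol t z)).comp h1)

theorem IsTame.interaction_lipschitz {N : H1 × H1 → H1 × H1} (hN : IsTame N) (R : ℝ) :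
    ∃ K : ℝ≥0, ∀ t, LipschitzOnWith K (interaction N t) (Metric.closedBall 0 R) := by
  obtain ⟨K, hK, hl⟩ := hN.lipschitz R
  refine ⟨⟨K, hK⟩, fun t => LipschitzOnWith.of_dist_le_mul fun x hx y hy => ?_⟩
  rw [mem_closedBall_zero_iff] at hx hy
  rw [dist_eq_norm, dist_eq_norm, interaction, interaction, ← map_sub, LinearIsometry.norm_map]
  refine (hl _ _ (by rwa [LinearIsometry.norm_map]) (by rwa [LinearIsometry.norm_map])).trans_eq ?_
  rw [← map_sub, LinearIsometry.norm_map]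
  rfl

/-- Solutions of the equation in the interaction picture are determined by their value at time
zero. -/
theorem IsTame.interaction_unique {N : H1 × H1 → H1 × H1} (hN : IsTame N) {a b : ℝ} (ha : a ≤ 0)
    (hb : 0 ≤ b) {y z : ℝ → H1 × H1}
    (hy : ∀ t ∈ Icc a b, HasDerivWithinAt y (interaction N t (y t)) (Icc a b) t)
    (hz : ∀ t ∈ Icc a b, HasDerivWithinAt z (interaction N t (z t)) (Icc a b) t)
    (h0 : y 0 = z 0) : EqOn y z (Icc a b) := by
  have hyc : ContinuousOn y (Icc a b) := fun t ht => (hy t ht).continuousWithinAt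
  have hzc : ContinuousOn z (Icc a b) := fun t ht => (hz t ht).continuousWithinAt
  obtain ⟨R, hR⟩ := isCompact_Icc.exists_bound_of_continuousOn hyc
  obtain ⟨R', hR'⟩ := isCompact_Icc.exists_bound_of_continuousOn hzc
  obtain ⟨K, hK⟩ := hN.interaction_lipschitz (max R R')
  have hys : ∀ t ∈ Icc a b, y t ∈ Metric.closedBall (0 : H1 × H1) (max R R') := fun t ht =>
    mem_closedBall_zero_iff.2 ((hR t ht).trans (le_max_left _ _))
  have hzs : ∀ t ∈ Icc a b, z t ∈ Metric.closedBall (0 : H1 × H1) (max R R') := fun t ht =>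
    mem_closedBall_zero_iff.2 ((hR' t ht).trans (le_max_right _ _))
  have s1 : Icc a 0 ⊆ Icc a b := Icc_subset_Icc_right hb
  have s2 : Icc 0 b ⊆ Icc a b := Icc_subset_Icc_left ha
  have s1' : Ioc a 0 ⊆ Icc a b := Ioc_subset_Icc_self.trans s1
  have s2' : Ico 0 b ⊆ Icc a b := Ico_subset_Icc_self.trans s2
  have m1 (t : ℝ) (ht : t ∈ Ioc a 0) : Icc a b ∈ 𝓝[≤] t :=
    mem_of_superset (Icc_mem_nhdsLE_of_mem ht) s1
  have m2 (t : ℝ) (ht : t ∈ Ico 0 b) : Icc a b ∈ 𝓝[≥] t :=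
    mem_of_superset (Icc_mem_nhdsGE_of_mem ht) s2
  have e1 : EqOn y z (Icc a 0) := ODE_solution_unique_of_mem_Icc_left (fun t _ => hK t)
    (hyc.mono s1) (fun t ht => (hy t (s1' ht)).mono_of_mem_nhdsWithin (m1 t ht))
    (fun t ht => hys t (s1' ht))
    (hzc.mono s1) (fun t ht => (hz t (s1' ht)).mono_of_mem_nhdsWithin (m1 t ht))
    (fun t ht => hzs t (s1' ht)) h0
  have e2 : EqOn y z (Icc 0 b) := ODE_solution_unique_of_mem_Icc_right (fun t _ => hK t)
    (hyc.mono s2) (fun t ht => (hy t (s2' ht)).mono_of_mem_nhdsWithin (m2 t ht))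
    (fun t ht => hys t (s2' ht))
    (hzc.mono s2) (fun t ht => (hz t (s2' ht)).mono_of_mem_nhdsWithin (m2 t ht))
    (fun t ht => hzs t (s2' ht)) h0
  intro t ht
  rcases le_total t 0 with h | h
  · exact e1 ⟨ht.1, h⟩
  · exact e2 ⟨h, ht.2⟩

/-! ### A priori bounds -/

/-- If the growth rate of `|u|²` and `|v|²` at each point of the line is at most the square of the
supremum norm, then the supremum norm grows at most exponentially. -/
theorem norm_bcfPair_le_mul_exp {z z' : ℝ → H1 × H1} {S : ℝ}
    (hz : ∀ t ∈ Icc 0 S, HasDerivWithinAt z (z' t) (Icc 0 S) t)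
    (h1 : ∀ t ∈ Icc 0 S, ∀ x,
      (star (toBCF (z t).1 x) * toBCF (z' t).1 x).re ≤ ‖bcfPair (z t)‖ ^ 2)
    (h2 : ∀ t ∈ Icc 0 S, ∀ x,
      (star (toBCF (z t).2 x) * toBCF (z' t).2 x).re ≤ ‖bcfPair (z t)‖ ^ 2) :
    ∀ t ∈ Icc 0 S, ‖bcfPair (z t)‖ ≤ ‖bcfPair (z 0)‖ * Real.exp t := by
  intro t ht
  have hS : 0 ≤ S := ht.1.trans ht.2
  let μ : ℝ → ℝ := fun t => ‖bcfPair (z t)‖ ^ 2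
  have hzc : ContinuousOn z (Icc 0 S) := fun t ht => (hz t ht).continuousWithinAt
  have hμ : ContinuousOn μ (Icc 0 S) := (bcfPair.continuous.comp_continuousOn hzc).norm.pow 2
  -- `B` dominates `|u|²` and `|v|²` at every point, hence it dominates `μ`.
  let B : ℝ → ℝ := ODE.picard (fun _ y => 2 * y) 0 (μ 0) μ
  have hB (t : ℝ) (ht : t ∈ Icc 0 S) : HasDerivWithinAt B (2 * μ t) (Icc 0 S) t :=
    ODE.hasDerivWithinAt_picard_Icc (u := univ) ⟨le_rfl, hS⟩
      (by fun_prop) hμ (fun _ _ => mem_univ _) (μ 0) ht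
  have hBc : ContinuousOn B (Icc 0 S) := fun t ht => (hB t ht).continuousWithinAt
  have hB0 : B 0 = μ 0 := by simp [B]
  have toIci {F : Type} [NormedAddCommGroup F] [NormedSpace ℝ F] {f : ℝ → F} {f' : F} {t : ℝ}
      (ht : t ∈ Ico 0 S) (h : HasDerivWithinAt f f' (Icc 0 S) t) :
      HasDerivWithinAt f f' (Ici t) t :=
    h.mono_of_mem_nhdsWithin (Icc_mem_nhdsGE_of_mem ht)
  have comp (L : H1 × H1 →L[ℝ] ℂ) (hL0 : ‖L (z 0)‖ ≤ ‖bcfPair (z 0)‖)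
      (hL : ∀ t ∈ Icc 0 S, (star (L (z t)) * L (z' t)).re ≤ μ t) :
      ∀ t ∈ Icc 0 S, ‖L (z t)‖ ^ 2 ≤ B t := by
    have hd (t : ℝ) (ht : t ∈ Icc 0 S) := (L.hasFDerivAt.comp_hasDerivWithinAt t (hz t ht)).norm_sq
    refine image_le_of_deriv_right_le_deriv_boundary
      (fun t ht => (hd t ht).continuousWithinAt)
      (fun t ht => toIci ht (hd t (Ico_subset_Icc_self ht))) ?_ hBc
      (fun t ht => toIci ht (hB t (Ico_subset_Icc_self ht))) (fun t ht => ?_)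
    · rw [hB0]
      exact pow_le_pow_left₀ (norm_nonneg _) hL0 2
    · have := hL t (Ico_subset_Icc_self ht)
      rw [Complex.inner, Function.comp_apply]
      rw [Complex.star_def, mul_comm] at this
      linarith
  let ev (x : ℝ) : BoundedContinuousFunction ℝ ℂ →L[ℝ] ℂ :=
    BoundedContinuousFunction.evalCLM ℝ x
  let p : H1 →L[ℝ] BoundedContinuousFunction ℝ ℂ := toBCF.restrictScalars ℝ
  have c1 (x : ℝ) := comp (((ev x).comp p).comp (ContinuousLinearMap.fst ℝ H1 H1))
    (((toBCF (z 0).1).norm_coe_le_norm x).trans (le_max_left _ _)) (fun t ht => h1 t ht x)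
  have c2 (x : ℝ) := comp (((ev x).comp p).comp (ContinuousLinearMap.snd ℝ H1 H1))
    (((toBCF (z 0).2).norm_coe_le_norm x).trans (le_max_right _ _)) (fun t ht => h2 t ht x)
  have hB_nonneg (t : ℝ) (ht : t ∈ Icc 0 S) : 0 ≤ B t := (sq_nonneg _).trans (c1 0 t ht)
  have hμB (t : ℝ) (ht : t ∈ Icc 0 S) : μ t ≤ B t := by
    have : ‖bcfPair (z t)‖ ≤ √(B t) := by
      rw [norm_bcfPair]
      refine max_le ?_ ?_ <;>
      rw [BoundedContinuousFunction.norm_le (Real.sqrt_nonneg _)] <;> intro x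
      · exact Real.le_sqrt_of_sq_le (c1 x t ht)
      · exact Real.le_sqrt_of_sq_le (c2 x t ht)
    calc μ t ≤ √(B t) ^ 2 := pow_le_pow_left₀ (norm_nonneg _) this 2
      _ = B t := Real.sq_sqrt (hB_nonneg t ht)
  have hG := norm_le_gronwallBound_of_norm_deriv_right_le (K := 2) (ε := 0) hBc
    (fun t ht => toIci ht (hB t (Ico_subset_Icc_self ht))) le_rfl (fun t ht => by
      have ht' := Ico_subset_Icc_self ht
      rw [Real.norm_of_nonneg (hB_nonneg t ht'), Real.norm_of_nonneg
        (mul_nonneg zero_le_two (sq_nonneg _)), add_zero]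
      exact mul_le_mul_of_nonneg_left (hμB t ht') zero_le_two) t ht
  rw [gronwallBound_ε0, sub_zero, Real.norm_of_nonneg (hB_nonneg t ht),
    Real.norm_of_nonneg (hB_nonneg 0 ⟨le_rfl, hS⟩), hB0] at hG
  refine le_of_sq_le_sq ?_ (by positivity)
  rw [mul_pow, ← Real.exp_nat_mul]
  exact (hμB t ht).trans hG

theorem toBCF_real_smul (c : ℝ) (f : H1) (x : ℝ) : toBCF (c • f) x = c * toBCF f x := by
  rw [ContinuousLinearMap.map_smul_of_tower]
  simp

theorem norm_bcfPair_real_smul (c : ℝ) (w : H1 × H1) : ‖bcfPair (c • w)‖ = |c| * ‖bcfPair w‖ := by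
  rw [ContinuousLinearMap.map_smul_of_tower, norm_smul, Real.norm_eq_abs]

/-- Scaling `a` and `b` by the factor `θ ∈ (0, 1]` of the truncation does not spoil the bound that
the gauge structure gives for the growth rate of `|a|²`. -/
theorem abs_re_le_sq_of_scaled {θ m : ℝ} {a b n : ℂ} (h0 : 0 < θ) (h1 : θ ≤ 1)
    (h : |(star (θ * a) * n).re| ≤ ‖θ * a‖ * ‖θ * b‖) (ha : ‖a‖ ≤ m) (hb : ‖b‖ ≤ m) :
    |(star a * n).re| ≤ m ^ 2 := by
  rw [star_mul', Complex.star_def, Complex.conj_ofReal, mul_assoc, Complex.re_ofReal_mul,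
    abs_mul, abs_of_pos h0, norm_mul, norm_mul, Complex.norm_real, Real.norm_of_nonneg h0.le,
    mul_assoc] at h
  refine (le_of_mul_le_mul_left h h0).trans ?_
  rw [sq]
  have hm : 0 ≤ m := (norm_nonneg a).trans ha
  gcongr
  exact (mul_le_of_le_one_left (norm_nonneg _) h1).trans hb

theorem IsDiracField.re_fst_le {W : ℂ → ℂ → ℝ} {N : H1 × H1 → H1 × H1} (hN : IsDiracField W N)
    {θ : ℝ} (h0 : 0 < θ) (h1 : θ ≤ 1) (w : H1 × H1) (x : ℝ) :
    |(star (toBCF w.1 x) * toBCF (N (θ • w)).1 x).re| ≤ ‖bcfPair w‖ ^ 2 := by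
  have h := hN.gauge_fst (θ • w) x
  rw [Prod.smul_fst, Prod.smul_snd, toBCF_real_smul, toBCF_real_smul] at h
  exact abs_re_le_sq_of_scaled h0 h1 h
    (((toBCF w.1).norm_coe_le_norm x).trans (le_max_left _ _))
    (((toBCF w.2).norm_coe_le_norm x).trans (le_max_right _ _))

theorem IsDiracField.re_snd_le {W : ℂ → ℂ → ℝ} {N : H1 × H1 → H1 × H1} (hN : IsDiracField W N)
    {θ : ℝ} (h0 : 0 < θ) (h1 : θ ≤ 1) (w : H1 × H1) (x : ℝ) :
    |(star (toBCF w.2 x) * toBCF (N (θ • w)).2 x).re| ≤ ‖bcfPair w‖ ^ 2 := by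
  have h := hN.gauge_snd (θ • w) x
  rw [Prod.smul_fst, Prod.smul_snd, toBCF_real_smul, toBCF_real_smul, mul_comm ‖_‖] at h
  exact abs_re_le_sq_of_scaled h0 h1 h
    (((toBCF w.2).norm_coe_le_norm x).trans (le_max_right _ _))
    (((toBCF w.1).norm_coe_le_norm x).trans (le_max_left _ _))

/-! ### Truncation and global existence -/

/-- The scaling factor of the radial retraction onto the closed ball of radius `R`. -/
def cutoff (R : ℝ) (w : H1 × H1) : ℝ := R / max R ‖w‖

theorem cutoff_pos {R : ℝ} (hR : 0 < R) (w : H1 × H1) : 0 < cutoff R w :=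
  div_pos hR (lt_max_of_lt_left hR)

theorem cutoff_le_one {R : ℝ} (hR : 0 < R) (w : H1 × H1) : cutoff R w ≤ 1 :=
  (div_le_one (lt_max_of_lt_left hR)).2 (le_max_left _ _)

theorem cutoff_eq_one {R : ℝ} (hR : 0 < R) {w : H1 × H1} (hw : ‖w‖ ≤ R) : cutoff R w = 1 := by
  rw [cutoff, max_eq_left hw, div_self hR.ne']

theorem norm_cutoff_smul {R : ℝ} (hR : 0 < R) (w : H1 × H1) :
    ‖cutoff R w • w‖ = cutoff R w * ‖w‖ := by
  rw [norm_smul, Real.norm_of_nonneg (cutoff_pos hR w).le]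

theorem norm_cutoff_smul_le {R : ℝ} (hR : 0 < R) (w : H1 × H1) : ‖cutoff R w • w‖ ≤ R := by
  have hm : 0 < max R ‖w‖ := lt_max_of_lt_left hR
  rw [norm_cutoff_smul hR, cutoff, div_mul_eq_mul_div, div_le_iff₀ hm]
  exact mul_le_mul_of_nonneg_left (le_max_right _ _) hR.le

theorem norm_cutoff_smul_sub_le {R : ℝ} (hR : 0 < R) (w w' : H1 × H1) :
    ‖cutoff R w • w - cutoff R w' • w'‖ ≤ 2 * ‖w - w'‖ := by
  have hm : 0 < max R ‖w‖ := lt_max_of_lt_left hR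
  have hm' : 0 < max R ‖w'‖ := lt_max_of_lt_left hR
  have h1 : |cutoff R w - cutoff R w'| * ‖w'‖ ≤ ‖w - w'‖ := by
    have e : cutoff R w - cutoff R w' =
        cutoff R w * ((max R ‖w'‖ - max R ‖w‖) / max R ‖w'‖) := by
      unfold cutoff; field_simp
    rw [e, abs_mul, abs_of_pos (cutoff_pos hR w), abs_div, abs_of_pos hm', mul_assoc]
    refine (mul_le_of_le_one_left (by positivity) (cutoff_le_one hR w)).trans ?_
    rw [div_mul_eq_mul_div, div_le_iff₀ hm']
    refine mul_le_mul ?_ (le_max_right _ _) (norm_nonneg _) (norm_nonneg _)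
    rw [max_comm R, max_comm R, norm_sub_rev]
    refine (abs_max_sub_max_le_abs ‖w'‖ ‖w‖ R).trans ?_
    exact abs_norm_sub_norm_le w' w
  have e : cutoff R w • w - cutoff R w' • w' =
      cutoff R w • (w - w') + (cutoff R w - cutoff R w') • w' := by module
  rw [e, two_mul]
  refine norm_add_le_of_le ?_ ?_
  · rw [norm_smul, Real.norm_of_nonneg (cutoff_pos hR w).le]
    exact mul_le_of_le_one_left (norm_nonneg _) (cutoff_le_one hR w)
  · rwa [norm_smul, Real.norm_eq_abs]

/-- The truncated field, which agrees with `N` on the ball of radius `R`, and is globally bounded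
and Lipschitz. -/
def truncate (R : ℝ) (N : H1 × H1 → H1 × H1) (w : H1 × H1) : H1 × H1 := N (cutoff R w • w)

/-- The a priori bounds do not see the truncation: a solution of the truncated equation obeys a
bound in `H¹(ℝ)` that depends on the initial value and the length of the time interval only. -/
theorem IsDiracField.norm_le_of_truncated {W : ℂ → ℂ → ℝ} {N : H1 × H1 → H1 × H1}
    (hN : IsDiracField W N) {S : ℝ} {z₀ : H1 × H1} {C : ℝ} (hC0 : 0 ≤ C)
    (hC : ∀ w, ‖bcfPair w‖ ≤ ‖bcfPair z₀‖ * Real.exp S → ‖N w‖ ≤ C * ‖w‖)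
    {R : ℝ} (hR : 0 < R) {z : ℝ → H1 × H1} (h0 : z 0 = z₀)
    (hz : ∀ t ∈ Icc (-S) S,
      HasDerivWithinAt z (interaction (truncate R N) t (z t)) (Icc (-S) S) t) :
    ∀ t ∈ Icc (-S) S, ‖z t‖ ≤ ‖z₀‖ * Real.exp (C * S) := by
  -- Both time directions are treated at once, with `ε` the direction of time.
  have key (ε : ℝ) (hε : |ε| = 1) : ∀ t ∈ Icc 0 S, ‖z (ε * t)‖ ≤ ‖z₀‖ * Real.exp (C * S) := by
    have hmaps : MapsTo (fun t => ε * t) (Icc 0 S) (Icc (-S) S) := fun t ht => by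
      rw [mem_Icc, ← abs_le, abs_mul, hε, one_mul, abs_of_nonneg ht.1]
      exact ht.2
    have hd (t : ℝ) (ht : t ∈ Icc 0 S) : HasDerivWithinAt (fun t => z (ε * t))
        (ε • interaction (truncate R N) (ε * t) (z (ε * t))) (Icc 0 S) t := by
      have h1 : HasDerivWithinAt (fun t => ε * t) ε (Icc 0 S) t := by
        simpa using ((hasDerivAt_id t).const_mul ε).hasDerivWithinAt
      exact (hz (ε * t) (hmaps ht)).scomp t h1 hmaps
    have hre (s : ℝ) (a b : ℂ) (h : |(star a * b).re| ≤ s) : (star a * (ε * b)).re ≤ s := by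
      rw [mul_left_comm, Complex.re_ofReal_mul]
      refine (le_abs_self _).trans ?_
      rwa [abs_mul, hε, one_mul]
    have hsup : ∀ t ∈ Icc 0 S, ‖bcfPair (z (ε * t))‖ ≤ ‖bcfPair z₀‖ * Real.exp t := by
      have := norm_bcfPair_le_mul_exp hd (fun t ht x => ?_) (fun t ht x => ?_)
      · simpa [h0] using this
      · set s := ε * t
        set w := evol s (z s) with hw
        have e1 : toBCF (z s).1 x = toBCF w.1 (x + s) := by
          rw [hw, evol_apply, toBCF_shiftH, add_neg_cancel_right]
        have e2 : toBCF (ε • interaction (truncate R N) s (z s)).1 x =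
            ε * toBCF (N (cutoff R w • w)).1 (x + s) := by
          rw [Prod.smul_fst, toBCF_real_smul, interaction, evol_apply, neg_neg, toBCF_shiftH,
            truncate]
        rw [e1, e2, ← norm_bcfPair_evol s]
        exact hre _ _ _ (hN.re_fst_le (cutoff_pos hR w) (cutoff_le_one hR w) w _)
      · set s := ε * t
        set w := evol s (z s) with hw
        have e1 : toBCF (z s).2 x = toBCF w.2 (x - s) := by
          rw [hw, evol_apply, toBCF_shiftH, sub_add_cancel]
        have e2 : toBCF (ε • interaction (truncate R N) s (z s)).2 x =
            ε * toBCF (N (cutoff R w • w)).2 (x - s) := by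
          rw [Prod.smul_snd, toBCF_real_smul, interaction, evol_apply, toBCF_shiftH, truncate,
            ← sub_eq_add_neg]
        rw [e1, e2, ← norm_bcfPair_evol s]
        exact hre _ _ _ (hN.re_snd_le (cutoff_pos hR w) (cutoff_le_one hR w) w _)
    intro t ht
    have hG := norm_le_gronwallBound_of_norm_deriv_right_le (K := C) (ε := 0)
      (fun t ht => (hd t ht).continuousWithinAt)
      (fun t ht => (hd t (Ico_subset_Icc_self ht)).mono_of_mem_nhdsWithin
        (Icc_mem_nhdsGE_of_mem ht)) le_rfl (fun t ht => by
        set s := ε * t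
        have hw : ‖bcfPair (cutoff R (evol s (z s)) • evol s (z s))‖ ≤
            ‖bcfPair z₀‖ * Real.exp S := by
          rw [norm_bcfPair_real_smul, abs_of_pos (cutoff_pos hR _), norm_bcfPair_evol]
          refine (mul_le_of_le_one_left (norm_nonneg _) (cutoff_le_one hR _)).trans ?_
          refine (hsup t (Ico_subset_Icc_self ht)).trans ?_
          gcongr
          exact ht.2.le
        rw [norm_smul, Real.norm_eq_abs, hε, one_mul, add_zero, interaction,
          LinearIsometry.norm_map, truncate]
        refine (hC _ hw).trans ?_
        gcongr
        rw [norm_cutoff_smul hR, LinearIsometry.norm_map]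
        exact mul_le_of_le_one_left (norm_nonneg _) (cutoff_le_one hR _)) t ht
    rw [gronwallBound_ε0, sub_zero, mul_zero, h0] at hG
    refine hG.trans ?_
    gcongr
    exact ht.2
  intro t ht
  rcases le_total 0 t with h | h
  · simpa using key 1 (by simp) t ⟨h, ht.2⟩
  · simpa using key (-1) (by simp) (-t) ⟨by linarith, by linarith [ht.1]⟩

/-- Existence on a bounded time interval: the Picard–Lindelöf theorem applies to the truncated
equation on the whole interval, and by the a priori bound its solution never reaches the
truncation. -/
theorem IsDiracField.exists_solution_Icc {W : ℂ → ℂ → ℝ} {N : H1 × H1 → H1 × H1}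
    (hN : IsDiracField W N) (z₀ : H1 × H1) {S : ℝ} (hS : 0 ≤ S) :
    ∃ z : ℝ → H1 × H1, z 0 = z₀ ∧
      ∀ t ∈ Icc (-S) S, HasDerivWithinAt z (interaction N t (z t)) (Icc (-S) S) t := by
  obtain ⟨C, hC0, hC⟩ := hN.tame.linear_bound (‖bcfPair z₀‖ * Real.exp S)
  set R : ℝ := ‖z₀‖ * Real.exp (C * S) + 1 with hRdef
  have hR : 0 < R := by positivity
  obtain ⟨K, hK, hl⟩ := hN.tame.lipschitz R
  obtain ⟨L, hL, hb⟩ := hN.tame.bounded R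
  have hlip (w w' : H1 × H1) : ‖truncate R N w - truncate R N w'‖ ≤ K * 2 * ‖w - w'‖ := by
    refine (hl _ _ (norm_cutoff_smul_le hR w) (norm_cutoff_smul_le hR w')).trans ?_
    rw [mul_assoc]
    exact mul_le_mul_of_nonneg_left (norm_cutoff_smul_sub_le hR w w') hK
  have htc : Continuous (truncate R N) :=
    (LipschitzWith.of_dist_le_mul (K := ⟨K * 2, by positivity⟩) fun w w' => by
      rw [dist_eq_norm, dist_eq_norm]; exact hlip w w').continuous
  have h0mem : (0 : ℝ) ∈ Icc (-S) S := ⟨by linarith, hS⟩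
  have hPL : IsPicardLindelof (interaction (truncate R N)) (⟨0, h0mem⟩ : Icc (-S) S) z₀
      (⟨L * S, by positivity⟩ : ℝ≥0) 0 ⟨L, hL⟩ ⟨K * 2, by positivity⟩ :=
    { lipschitzOnWith := fun t _ => LipschitzOnWith.of_dist_le_mul fun x _ y _ => by
        rw [dist_eq_norm, dist_eq_norm, interaction, interaction, ← map_sub,
          LinearIsometry.norm_map]
        refine (hlip _ _).trans_eq ?_
        rw [← map_sub, LinearIsometry.norm_map]
        rfl
      continuousOn := fun x _ => (continuous_interaction htc x).continuousOn
      norm_le := fun t _ x _ => by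
        rw [interaction, LinearIsometry.norm_map]
        exact hb _ (norm_cutoff_smul_le hR _)
      mul_max_le := by
        simp only [sub_zero, zero_sub, neg_neg, max_self, NNReal.coe_zero]
        exact le_rfl }
  obtain ⟨z, hz0, hz⟩ := hPL.exists_eq_forall_mem_Icc_hasDerivWithinAt₀
  refine ⟨z, hz0, fun t ht => ?_⟩
  have hbd := hN.norm_le_of_truncated hC0 hC hR hz0 hz t ht
  have e : interaction (truncate R N) t (z t) = interaction N t (z t) := by
    rw [interaction, truncate, cutoff_eq_one hR, one_smul, interaction]
    rw [LinearIsometry.norm_map]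
    linarith
  rw [← e]
  exact hz t ht

/-- Global existence, by gluing the solutions on the intervals `[-(n + 1), n + 1]`. -/
theorem IsDiracField.exists_solution {W : ℂ → ℂ → ℝ} {N : H1 × H1 → H1 × H1}
    (hN : IsDiracField W N) (z₀ : H1 × H1) :
    ∃ z : ℝ → H1 × H1, z 0 = z₀ ∧ ∀ t, HasDerivAt z (interaction N t (z t)) t := by
  choose Z hZ0 hZ using fun n : ℕ =>
    hN.exists_solution_Icc z₀ (by positivity : (0 : ℝ) ≤ (n : ℝ) + 1)
  have mono {m n : ℕ} (hmn : m ≤ n) :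
      EqOn (Z m) (Z n) (Icc (-((m : ℝ) + 1)) ((m : ℝ) + 1)) := by
    have hmn' : (m : ℝ) + 1 ≤ (n : ℝ) + 1 := by gcongr
    have hsub := Icc_subset_Icc (neg_le_neg hmn') hmn'
    exact hN.tame.interaction_unique (by linarith [m.cast_nonneg (α := ℝ)]) (by positivity) (hZ m)
      (fun t ht => (hZ n t (hsub ht)).mono hsub) (by rw [hZ0, hZ0])
  have agree (n : ℕ) (s : ℝ) (hs : s ∈ Icc (-((n : ℝ) + 1)) ((n : ℝ) + 1)) :
      Z ⌈|s|⌉₊ s = Z n s := by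
    rcases le_total ⌈|s|⌉₊ n with h | h
    · refine mono h ?_
      rw [mem_Icc, ← abs_le]
      linarith [Nat.le_ceil |s|]
    · exact (mono h hs).symm
  refine ⟨fun t => Z ⌈|t|⌉₊ t, hZ0 _, fun t => ?_⟩
  set n := ⌈|t|⌉₊
  have ht : t ∈ Ioo (-((n : ℝ) + 1)) ((n : ℝ) + 1) := by
    rw [mem_Ioo, ← abs_lt]
    linarith [Nat.le_ceil |t|]
  have hnhds := Icc_mem_nhds ht.1 ht.2
  refine ((hZ n t (Ioo_subset_Icc_self ht)).hasDerivAt hnhds).congr_of_eventuallyEq ?_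
  filter_upwards [hnhds] with s hs
  exact agree n s hs

/-! ### Equivalence of the Dirac equations with the interaction picture -/

/-- The embedding `H¹(ℝ) × H¹(ℝ) → L²(ℝ) × L²(ℝ)`. -/
def pairToL2 : H1 × H1 →L[ℝ] L2 × L2 := (toL2L.prodMap toL2L).restrictScalars ℝ

theorem pairToL2_apply (w : H1 × H1) : pairToL2 w = (w.1.toL2, w.2.toL2) := rfl

theorem pairToL2_injective : Function.Injective pairToL2 := fun w w' h => by
  rw [pairToL2_apply, pairToL2_apply, Prod.mk.injEq] at h
  exact Prod.ext (toL2_injective h.1) (toL2_injective h.2)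

theorem IsDiracField.fst_ae {W : ℂ → ℂ → ℝ} {N : H1 × H1 → H1 × H1} (hN : IsDiracField W N)
    (w : H1 × H1) : ∀ᵐ x : ℝ, (N w).1.toL2 x = Complex.I * w.2.toL2 x -
      Complex.I * wirtingerBar (fun z => W z (w.2.toL2 x)) (w.1.toL2 x) := by
  filter_upwards [toBCF_ae (N w).1, toBCF_ae w.1, toBCF_ae w.2] with x h1 h2 h3
  rw [h1, h2, h3, hN.fst]

theorem IsDiracField.snd_ae {W : ℂ → ℂ → ℝ} {N : H1 × H1 → H1 × H1} (hN : IsDiracField W N)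
    (w : H1 × H1) : ∀ᵐ x : ℝ, (N w).2.toL2 x = Complex.I * w.1.toL2 x -
      Complex.I * wirtingerBar (fun z => W (w.1.toL2 x) z) (w.2.toL2 x) := by
  filter_upwards [toBCF_ae (N w).2, toBCF_ae w.1, toBCF_ae w.2] with x h1 h2 h3
  rw [h1, h2, h3, hN.snd]

theorem I_mul_add_eq_iff (a b q : ℂ) :
    Complex.I * a + b = q ↔ a = Complex.I * b - Complex.I * q := by
  constructor
  · rintro rfl
    linear_combination a * Complex.I_mul_I
  · rintro rfl
    linear_combination (b - q) * Complex.I_mul_I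

/-- The first Dirac equation, as an identity in `L²(ℝ)`. -/
theorem IsDiracField.equation_fst_iff {W : ℂ → ℂ → ℝ} {N : H1 × H1 → H1 × H1}
    (hN : IsDiracField W N) (w : H1 × H1) (ut : L2) :
    (∀ᵐ x : ℝ, Complex.I * (ut x + w.1.dx x) + w.2.toL2 x =
      wirtingerBar (fun z => W z (w.2.toL2 x)) (w.1.toL2 x)) ↔ ut + w.1.dx = (N w).1.toL2 := by
  constructor
  · intro h
    apply Lp.ext
    filter_upwards [h, hN.fst_ae w, Lp.coeFn_add ut w.1.dx] with x h1 h2 h3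
    rw [h2, h3, Pi.add_apply, ← I_mul_add_eq_iff, h1]
  · intro h
    filter_upwards [hN.fst_ae w, Lp.coeFn_add ut w.1.dx] with x h2 h3
    rw [I_mul_add_eq_iff, ← h2, ← Pi.add_apply, ← h3, h]

/-- The second Dirac equation, as an identity in `L²(ℝ)`. -/
theorem IsDiracField.equation_snd_iff {W : ℂ → ℂ → ℝ} {N : H1 × H1 → H1 × H1}
    (hN : IsDiracField W N) (w : H1 × H1) (vt : L2) :
    (∀ᵐ x : ℝ, Complex.I * (vt x - w.2.dx x) + w.1.toL2 x =
      wirtingerBar (fun z => W (w.1.toL2 x) z) (w.2.toL2 x)) ↔ vt - w.2.dx = (N w).2.toL2 := by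
  constructor
  · intro h
    apply Lp.ext
    filter_upwards [h, hN.snd_ae w, Lp.coeFn_sub vt w.2.dx] with x h1 h2 h3
    rw [h2, h3, Pi.sub_apply, ← I_mul_add_eq_iff, h1]
  · intro h
    filter_upwards [hN.snd_ae w, Lp.coeFn_sub vt w.2.dx] with x h2 h3
    rw [I_mul_add_eq_iff, ← h2, ← Pi.sub_apply, ← h3, h]

theorem IsDiracSolutionOn.mono {W : ℂ → ℂ → ℝ} {J J' : Set ℝ} {w : ℝ → H1 × H1}
    (h : IsDiracSolutionOn W J w) (hJ : J' ⊆ J) : IsDiracSolutionOn W J' w where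
  continuousOn := h.continuousOn.mono hJ
  equation t ht := by
    obtain ⟨ut, vt, hu, hv, h1, h2⟩ := h.equation t (hJ ht)
    exact ⟨ut, vt, hu.mono hJ, hv.mono hJ, h1, h2⟩

/-- A solution of the Dirac equations, seen from the frame moving with the free evolution, solves
the equation in the interaction picture. At first this holds in `L²(ℝ)`; since the right-hand side
is continuous in time with values in `H¹(ℝ)`, integrating it gives the derivative in `H¹(ℝ)`. -/
theorem IsDiracSolutionOn.hasDerivWithinAt_evol {W : ℂ → ℂ → ℝ} {N : H1 × H1 → H1 × H1}
    (hN : IsDiracField W N) {a b : ℝ} (ha : a ≤ 0) (hb : 0 ≤ b) {w : ℝ → H1 × H1}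
    (hw : IsDiracSolutionOn W (Icc a b) w) :
    ∀ t ∈ Icc a b, HasDerivWithinAt (fun s => evol (-s) (w s))
      (interaction N t (evol (-t) (w t))) (Icc a b) t := by
  let z : ℝ → H1 × H1 := fun s => evol (-s) (w s)
  let F : ℝ → H1 × H1 := fun s => evol (-s) (N (w s))
  have hF (t : ℝ) : interaction N t (evol (-t) (w t)) = F t := by
    rw [interaction, evol_evol_neg]
  have hFc : ContinuousOn F (Icc a b) := fun t ht =>
    tendsto_evol ((continuous_neg.tendsto t).mono_left nhdsWithin_le_nhds)
      ((hN.tame.continuous.tendsto (w t)).comp (hw.continuousOn t ht))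
  have hL2 (t : ℝ) (ht : t ∈ Icc a b) :
      HasDerivWithinAt (fun s => pairToL2 (z s)) (pairToL2 (F t)) (Icc a b) t := by
    obtain ⟨ut, vt, hu, hv, h1, h2⟩ := hw.equation t ht
    rw [hN.equation_fst_iff] at h1
    rw [hN.equation_snd_iff] at h2
    have e1 := hasDerivWithinAt_shift (σ := 1) hu (w t).1.hasWeakDeriv
    have e2 := hasDerivWithinAt_shift (σ := -1) hv (w t).2.hasWeakDeriv
    rw [one_smul, h1] at e1
    rw [neg_one_smul, ← sub_eq_add_neg, h2] at e2
    simp only [one_mul, neg_one_mul] at e1 e2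
    have e3 := e1.prodMk e2
    simpa only [z, F, pairToL2_apply, evol_apply, toL2_shiftH, neg_neg] using e3
  let y : ℝ → H1 × H1 := ODE.picard (fun s _ => F s) 0 (z 0) z
  have hzc : ContinuousOn z (Icc a b) := fun t ht =>
    tendsto_evol ((continuous_neg.tendsto t).mono_left nhdsWithin_le_nhds) (hw.continuousOn t ht)
  have hFu : ContinuousOn (Function.uncurry fun s (_ : H1 × H1) => F s) (Icc a b ×ˢ univ) :=
    hFc.comp continuousOn_fst fun p hp => hp.1
  have hy (t : ℝ) (ht : t ∈ Icc a b) : HasDerivWithinAt y (F t) (Icc a b) t :=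
    ODE.hasDerivWithinAt_picard_Icc (u := univ) ⟨ha, hb⟩ hFu hzc (fun _ _ => mem_univ _) (z 0) ht
  have hdiff (t : ℝ) (ht : t ∈ Icc a b) :
      HasDerivWithinAt (fun s => pairToL2 (y s) - pairToL2 (z s)) 0 (Icc a b) t := by
    rw [← sub_self (pairToL2 (F t))]
    exact (pairToL2.hasFDerivAt.comp_hasDerivWithinAt t (hy t ht)).sub (hL2 t ht)
  have hconst := constant_of_has_deriv_right_zero
    (fun t ht => (hdiff t ht).continuousWithinAt) (fun t ht =>
      (hdiff t (Ico_subset_Icc_self ht)).mono_of_mem_nhdsWithin (Icc_mem_nhdsGE_of_mem ht))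
  have hy0 : y 0 = z 0 := ODE.picard_apply₀
  have hyz : ∀ t ∈ Icc a b, z t = y t := fun t ht => by
    apply pairToL2_injective
    have h0 := hconst 0 ⟨ha, hb⟩
    rw [hy0, sub_self] at h0
    have := hconst t ht
    rw [← h0, sub_eq_zero] at this
    exact this.symm
  intro t ht
  rw [hF]
  exact (hy t ht).congr hyz (hyz t ht)

/-- Integral curves of the interaction picture yield solutions of the Dirac equations. -/
theorem isDiracSolutionOn_evol {W : ℂ → ℂ → ℝ} {N : H1 × H1 → H1 × H1} (hN : IsDiracField W N)
    {z : ℝ → H1 × H1} (hz : ∀ t, HasDerivAt z (interaction N t (z t)) t) :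
    IsDiracSolutionOn W univ fun t => evol t (z t) where
  continuousOn t _ := tendsto_evol (tendsto_id.mono_left nhdsWithin_le_nhds)
    ((hz t).continuousAt.tendsto.mono_left nhdsWithin_le_nhds)
  equation t _ := by
    let L : H1 →L[ℝ] L2 := toL2L.restrictScalars ℝ
    have h1 : HasDerivWithinAt (fun s => (z s).1.toL2) (interaction N t (z t)).1.toL2 univ t :=
      (L.comp (ContinuousLinearMap.fst ℝ H1 H1)).hasFDerivAt.comp_hasDerivWithinAt t
        (hz t).hasDerivWithinAt
    have h2 : HasDerivWithinAt (fun s => (z s).2.toL2) (interaction N t (z t)).2.toL2 univ t :=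
      (L.comp (ContinuousLinearMap.snd ℝ H1 H1)).hasFDerivAt.comp_hasDerivWithinAt t
        (hz t).hasDerivWithinAt
    have e1 := hasDerivWithinAt_shift (σ := -1) h1 (z t).1.hasWeakDeriv
    have e2 := hasDerivWithinAt_shift (σ := 1) h2 (z t).2.hasWeakDeriv
    simp only [one_mul, neg_one_mul, one_smul, neg_one_smul] at e1 e2
    refine ⟨_, _, e1, e2, ?_, ?_⟩
    · rw [hN.equation_fst_iff]
      change shift (-t) (shift (- -t) (N (evol t (z t))).1.toL2 + -(z t).1.dx) +
        shift (-t) (z t).1.dx = _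
      rw [← map_add, neg_add_cancel_right, shift_shift, add_neg_cancel, shift_zero]
    · rw [hN.equation_snd_iff]
      change shift t (shift (-t) (N (evol t (z t))).2.toL2 + (z t).2.dx) -
        shift t (z t).2.dx = _
      rw [← map_sub, add_sub_cancel_right, shift_shift, add_neg_cancel, shift_zero]

/-- Two solutions on a time interval containing `0` agree if they agree at time `0`. -/
theorem IsDiracSolutionOn.eqOn {W : ℂ → ℂ → ℝ} {N : H1 × H1 → H1 × H1} (hN : IsDiracField W N)
    {a b : ℝ} (ha : a ≤ 0) (hb : 0 ≤ b) {w w' : ℝ → H1 × H1}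
    (hw : IsDiracSolutionOn W (Icc a b) w) (hw' : IsDiracSolutionOn W (Icc a b) w')
    (h0 : w 0 = w' 0) : EqOn w w' (Icc a b) := fun t ht => by
  have := hN.tame.interaction_unique ha hb (hw.hasDerivWithinAt_evol hN ha hb)
    (hw'.hasDerivWithinAt_evol hN ha hb) (by rw [h0]) ht
  exact (evol (-t)).injective this

end DiracH1

end

theorem mainTheorem1 (W : ℂ → ℂ → ℝ) (hW : DiracH1.IsPolynomialInModuli W)
    (T : ℝ) (hT : 0 < T) (w : ℝ → DiracH1.H1 × DiracH1.H1)
    (hw : DiracH1.IsDiracSolutionOn W (Set.Icc 0 T) w) :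
    ∃! w' : ℝ → DiracH1.H1 × DiracH1.H1,
      DiracH1.IsDiracSolutionOn W Set.univ w' ∧ Set.EqOn w' w (Set.Icc 0 T) := by
  obtain ⟨N, hN⟩ := DiracH1.exists_isDiracField hW
  -- The extension is the global solution with initial value `w 0`; both its agreement with `w` and
  -- its uniqueness follow from uniqueness for the initial value at time `0`.
  obtain ⟨z, hz0, hz⟩ := hN.exists_solution (w 0)
  have hsol := DiracH1.isDiracSolutionOn_evol hN hz
  have hsol0 : DiracH1.evol 0 (z 0) = w 0 := by rw [DiracH1.evol_zero, hz0]
  refine ⟨fun t => DiracH1.evol t (z t), ⟨hsol, ?_⟩, ?_⟩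
  · exact (hsol.mono (Set.subset_univ _)).eqOn hN le_rfl hT.le hw hsol0
  · rintro w' ⟨hw', heq⟩
    funext t
    have h0 : w' 0 = DiracH1.evol 0 (z 0) := (heq ⟨le_rfl, hT.le⟩).trans hsol0.symm
    exact (hw'.mono (Set.subset_univ _)).eqOn hN (neg_nonpos.2 (abs_nonneg t)) (abs_nonneg t)
      (hsol.mono (Set.subset_univ _)) h0 (abs_le.1 (le_refl |t|))
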